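/- Let $T>0$, $\omega=2\pi/T$, $j=\sqrt{-1}$, and let $A:\mathbb R\to\mathbb C^{n\times n}$, $B:\mathbb R\to\mathbb C^{n\times r}$, $G:\mathbb R\to\mathbb C^{r\times n}$ be $T$-periodic with entries in $L^\infty([0,T])$; let $\Lambda\in\mathbb C^{n\times n}$ (for instance a Jordan normal form). For a $T$-periodic scalar function $f$ let $f_k=\frac1T\int_{t-T}^{t}f(\tau)e^{-j\omega k\tau}\,d\tau$, $k\in\mathbb Z$, be its phasors (independent of $t$). For a $T$-periodic matrix function $F$ let $\mathcal T(F)$ be the infinite block matrix whose block $(a,b)$ is the Toeplitz matrix $\big((F_{ab})_{k-l}\big)_{k,l\in\mathbb Z}$, let $\mathbf F$ be the collection of the phasors of its entries, and let $col(\mathbf F)$ be the vector obtained by stacking these by columns (the position $(b,a,k)$ holds $(F_{ab})_k$). Put $\mathcal A=\mathcal T(A)$, $\mathcal N=Id_n\otimes diag(j\omega k,\ k\in\mathbb Z)$, $\mathcal I$ the identity indexed by $\mathbb Z$, $Q=BG$. For an $n\times n$ matrix $M$ and a block matrix $\mathcal M=(\mathcal M_{ab})_{a,b\le n}$ let $M\circ\mathcal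 M$ be the block matrix with blocks $M\otimes\mathcal M_{ab}$. The prime denotes the transpose. Infinite matrices act on $\ell^2$ as operators with their maximal domains, and the spectrum $\sigma$ is the set of $\mu$ for which the operator minus $\mu$ has no bounded inverse on $\ell^2$. Assume that $\sigma(\mathcal A-\mathcal N)\cap\sigma(\Lambda\otimes\mathcal I-\mathcal N)=\emptyset$. For $m\in\mathbb N$ let $\mathcal A_m,\mathcal N_m,Id_m$ be the truncations of $\mathcal A,\mathcal N,\mathcal I$ in which each block keeps only its rows and columns of index $|k|\le m$, and let $\mathbf Q|_m$ be the phasors of $Q$ of order $|k|\le m$. Then: 1. The operator $Id_n\otimes(\mathcal A-\mathcal N)-Id_n\circ(\Lambda\otimes\mathcal I)'$ has a bounded inverse on $\ell^2$, $col(\mathbf Q)\in\ell^2$, and there is a $T$-periodic $P\in L^2([0,T],\mathbb C^{n\times n})$ with $$col(\mathbf P)=\big(Id_n\otimes(\mathcal A-\mathcal N)-Id_n\circ(\Lambda\otimes\mathcal I)'\big)^{-1}col(\mathbf Q).$$ 2. For every such $P$, $\mathcal P:=\mathcal T(P)$ is a bounded operator on $\ell^2$, and for every $\varepsilon>0$ there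 is $m_0$ such that for all $m\ge m_0$ the finite matrix $Id_n\otimes(\mathcal A_m-\mathcal N_m)-Id_n\circ(\Lambda\otimes Id_m)'$ is invertible and the $m$-truncated solution $$col(\tilde{\mathbf P}_m):=\big(Id_n\otimes(\mathcal A_m-\mathcal N_m)-Id_n\circ(\Lambda\otimes Id_m)'\big)^{-1}col(\mathbf Q|_m)$$ (extended by zero to the orders $|k|>m$) satisfies $$\|col(\mathbf P-\tilde{\mathbf P}_m)\|_{\ell^2}<\varepsilon ;$$ moreover, with $\tilde P_m(t)=\sum_{|k|\le m}\tilde{\mathbf P}_{m,k}e^{j\omega kt}$ and $\tilde{\mathcal P}_m:=\mathcal T(\tilde P_m)$, which is a bounded operator on $\ell^2$, $$\|\mathcal P-\tilde{\mathcal P}_m\|_{\ell^2\to\ell^2}<\varepsilon .$$ -/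

import Mathlib

open scoped Kronecker ENNReal
open MeasureTheory

/-! ### Unbounded operators on `ℓ²` given by infinite matrices -/

/-- The Hilbert space `ℓ²` of square-summable complex families indexed by `ι`. -/
noncomputable abbrev Ell2 (ι : Type*) := lp (fun _ : ι => ℂ) 2

/-- The (in general unbounded) operator on `ℓ²` defined by an infinite matrix `M`, on its maximal
domain: those `x ∈ ℓ²` for which every row sum of `M x` converges and `M x` lies in `ℓ²`. -/
noncomputable def matrixOp {ι : Type*} (M : Matrix ι ι ℂ) : Ell2 ι →ₗ.[ℂ] Ell2 ι where
  domain :=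
    { carrier := {x | (∀ i, Summable fun j => M i j * x j) ∧
        Memℓp (fun i => ∑' j, M i j * x j) 2}
      zero_mem' := by
        refine ⟨fun i => ?_, ?_⟩
        · simp
        · convert (zero_memℓp : Memℓp (0 : ι → ℂ) 2) using 1
          funext i
          simp
      add_mem' := by
        rintro x y ⟨hx, hx'⟩ ⟨hy, hy'⟩
        refine ⟨fun i => ?_, ?_⟩
        · simpa [mul_add] using (hx i).add (hy i)
        · convert hx'.add hy' using 1
          funext i
          simpa [mul_add] using (hx i).tsum_add (hy i)
      smul_mem' := by
        rintro c x ⟨hx, hx'⟩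
        refine ⟨fun i => ?_, ?_⟩
        · simpa [mul_left_comm] using (hx i).mul_left c
        · convert hx'.const_smul c using 1
          funext i
          simp [mul_left_comm, tsum_mul_left] }
  toFun :=
    { toFun := fun x => ⟨fun i => ∑' j, M i j * (x : Ell2 ι) j, x.2.2⟩
      map_add' := by
        intro x y
        ext i
        have h := (x.2.1 i).tsum_add (y.2.1 i)
        simp only [← mul_add] at h
        exact h
      map_smul' := by
        intro c x
        ext i
        simp [mul_left_comm, tsum_mul_left] }

/-- `R` is the bounded inverse of the (possibly unbounded) operator `L`: it maps the whole space
into the domain of `L`, with `L R y = y` for every `y`, and `R L x = x` on the domain of `L`. -/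
def IsBoundedInverse {E : Type*} [NormedAddCommGroup E] [NormedSpace ℂ E]
    (L : E →ₗ.[ℂ] E) (R : E →L[ℂ] E) : Prop :=
  (∀ y : E, ∃ hy : R y ∈ L.domain, L ⟨R y, hy⟩ = y) ∧ ∀ x : L.domain, R (L x) = x

/-- The spectrum of the operator defined by the infinite matrix `M`: those `μ` for which
`M - μ I` does not have a bounded inverse on `ℓ²`. -/
def matrixSpectrum {ι : Type*} [DecidableEq ι] (M : Matrix ι ι ℂ) : Set ℂ :=
  {μ | ¬ ∃ R : Ell2 ι →L[ℂ] Ell2 ι, IsBoundedInverse (matrixOp (M - μ • (1 : Matrix ι ι ℂ))) R}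

/-- The bounded operator `D` on `ℓ²` is the one defined by the infinite matrix `M`. -/
def HasMatrix {ι : Type*} (D : Ell2 ι →L[ℂ] Ell2 ι) (M : Matrix ι ι ℂ) : Prop :=
  ∀ (x : Ell2 ι) (i : ι), HasSum (fun j => M i j * x j) (D x i)

/-- The family `f` is square-summable and its `ℓ²` norm is smaller than `ε`. -/
def Ell2NormLT {ι : Type*} (f : ι → ℂ) (ε : ℝ) : Prop :=
  ∃ h : Memℓp f 2, ‖(⟨f, h⟩ : Ell2 ι)‖ < ε

/-! ### Periodic matrix functions, phasors and Toeplitz matrices -/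

/-- `F` is a `T`-periodic matrix function whose entries are of class `L^p` on `[0, T]`. -/
def PeriodicLp {a b : ℕ} (p : ℝ≥0∞) (T : ℝ) (F : ℝ → Matrix (Fin a) (Fin b) ℂ) : Prop :=
  Function.Periodic F T ∧
    ∀ i j, MemLp (fun t => F t i j) p (volume.restrict (Set.Icc 0 T))

/-- The `k`-th sliding phasor `(1 / T) ∫_{t-T}^t f(τ) e^{-jωkτ} dτ`, where `ω = 2π / T`. -/
noncomputable def slidingPhasor (T : ℝ) (f : ℝ → ℂ) (k : ℤ) (t : ℝ) : ℂ :=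
  (1 / T : ℂ) * ∫ τ in (t - T)..t,
    f τ * Complex.exp (-(Complex.I * (2 * Real.pi / T : ℝ) * k * τ))

/-- For a `T`-periodic function the sliding phasors do not depend on `t`. -/
theorem slidingPhasor_eq {T : ℝ} (hT : 0 < T) {f : ℝ → ℂ} (hf : Function.Periodic f T)
    (k : ℤ) (s t : ℝ) : slidingPhasor T f k s = slidingPhasor T f k t := by
  have hper : Function.Periodic
      (fun τ : ℝ => f τ * Complex.exp (-(Complex.I * (2 * Real.pi / T : ℝ) * k * τ))) T := by
    intro τ
    have hT' : (T : ℂ) ≠ 0 := by exact_mod_cast hT.ne'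
    have h : -(Complex.I * (2 * Real.pi / T : ℝ) * k * ((τ + T : ℝ) : ℂ)) =
        -(Complex.I * (2 * Real.pi / T : ℝ) * k * τ) +
          ((-k : ℤ) : ℂ) * (2 * Real.pi * Complex.I) := by
      push_cast
      field_simp
      ring
    simp only [hf τ, h, Complex.exp_add, Complex.exp_int_mul_two_pi_mul_I, mul_one]
  have h := hper.intervalIntegral_add_eq (s - T) (t - T)
  simp only [sub_add_cancel] at h
  simp only [slidingPhasor, h]

/-- The phasors of a `T`-periodic function (the constant value of its sliding phasors). -/
noncomputable def phasor (T : ℝ) (f : ℝ → ℂ) (k : ℤ) : ℂ := slidingPhasor T f k T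

/-- The block Toeplitz transformation `𝒯(F)`: its block `(i, j)` is the Toeplitz matrix with
`(k, l)` entry the phasor of order `k - l` of the entry `F i j`. -/
noncomputable def blockToeplitz {a b : ℕ} (T : ℝ) (F : ℝ → Matrix (Fin a) (Fin b) ℂ) :
    Matrix (Fin a × ℤ) (Fin b × ℤ) ℂ :=
  Matrix.of fun p q => phasor T (fun t => F t p.1 q.1) (p.2 - q.2)

/-- `col(𝓕(F))`: the phasors of a matrix function, stacked by columns; the position `(j, (i, k))`
holds the phasor of order `k` of the entry `F i j`. -/
noncomputable def colPhasor {n : ℕ} (T : ℝ) (F : ℝ → Matrix (Fin n) (Fin n) ℂ) :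
    Fin n × (Fin n × ℤ) → ℂ :=
  fun p => phasor T (fun t => F t p.2.1 p.1) p.2.2

/-- `𝒩 = Id_n ⊗ diag(jωk)`. The harmonics `k` are enumerated by `h : κ → ℤ`: all of `ℤ` for the
infinite matrix, and those with `|k| ≤ m` for its `m`-truncation. -/
noncomputable def harmonicN (n : ℕ) (T : ℝ) {κ : Type} [DecidableEq κ] (h : κ → ℤ) :
    Matrix (Fin n × κ) (Fin n × κ) ℂ :=
  (1 : Matrix (Fin n) (Fin n) ℂ) ⊗ₖ
    Matrix.diagonal fun k => Complex.I * (2 * Real.pi / T : ℝ) * (h k : ℂ)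

/-- The product `B ∘ ℳ` of a matrix `B` with a block matrix `ℳ`: its block `(i, j)` is the
Kronecker product `B ⊗ ℳ_{ij}`. -/
def circProd {n : ℕ} {κ : Type} (B : Matrix (Fin n) (Fin n) ℂ)
    (M : Matrix (Fin n × κ) (Fin n × κ) ℂ) :
    Matrix (Fin n × (Fin n × κ)) (Fin n × (Fin n × κ)) ℂ :=
  Matrix.of fun p q => B p.2.1 q.2.1 * M (p.1, p.2.2) (q.1, q.2.2)

/-- The infinite matrix `Id_n ⊗ (𝒜 - 𝒩) - Id_n ∘ (Λ ⊗ ℐ)'`, where `𝒜 = 𝒯(A)`. -/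
noncomputable def sylvesterMatrix {n : ℕ} (T : ℝ) (A : ℝ → Matrix (Fin n) (Fin n) ℂ)
    (Λ : Matrix (Fin n) (Fin n) ℂ) :
    Matrix (Fin n × (Fin n × ℤ)) (Fin n × (Fin n × ℤ)) ℂ :=
  (1 : Matrix (Fin n) (Fin n) ℂ) ⊗ₖ (blockToeplitz T A - harmonicN n T (fun k : ℤ => k)) -
    circProd 1 (Λ ⊗ₖ (1 : Matrix ℤ ℤ ℂ)).transpose

/-! ### The truncated problem -/

/-- The harmonics `k` with `|k| ≤ m`. -/
noncomputable abbrev Harm (m : ℕ) : Type := {k : ℤ // k ∈ Finset.Icc (-(m : ℤ)) m}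

/-- The `m`-truncation of a block matrix: each block is cut down to the rows and columns `k` with
`|k| ≤ m`. -/
noncomputable def truncMatrix {n : ℕ} (m : ℕ) (M : Matrix (Fin n × ℤ) (Fin n × ℤ) ℂ) :
    Matrix (Fin n × Harm m) (Fin n × Harm m) ℂ :=
  M.submatrix (fun p => (p.1, (p.2 : ℤ))) (fun p => (p.1, (p.2 : ℤ)))

/-- The finite matrix `Id_n ⊗ (𝒜_m - 𝒩_m) - Id_n ∘ (Λ ⊗ Id_m)'`. -/
noncomputable def truncSylvesterMatrix {n : ℕ} (T : ℝ) (A : ℝ → Matrix (Fin n) (Fin n) ℂ)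
    (Λ : Matrix (Fin n) (Fin n) ℂ) (m : ℕ) :
    Matrix (Fin n × (Fin n × Harm m)) (Fin n × (Fin n × Harm m)) ℂ :=
  (1 : Matrix (Fin n) (Fin n) ℂ) ⊗ₖ
      (truncMatrix m (blockToeplitz T A) - harmonicN n T (fun k : Harm m => (k : ℤ))) -
    circProd 1 (Λ ⊗ₖ (1 : Matrix (Harm m) (Harm m) ℂ)).transpose

/-- The `m`-truncated solution `col(𝐏̃_m)`: the inverse of the truncated matrix applied to the
phasors of order at most `m` of `Q`. -/
noncomputable def truncSolution {n : ℕ} (T : ℝ) (A : ℝ → Matrix (Fin n) (Fin n) ℂ)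
    (Λ : Matrix (Fin n) (Fin n) ℂ) (Q : ℝ → Matrix (Fin n) (Fin n) ℂ) (m : ℕ) :
    Fin n × (Fin n × Harm m) → ℂ :=
  (truncSylvesterMatrix T A Λ m)⁻¹.mulVec
    fun p => colPhasor T Q (p.1, (p.2.1, (p.2.2 : ℤ)))

/-- Extension by zero of a truncated column of phasors to all orders `k ∈ ℤ`. -/
noncomputable def extendByZero {n m : ℕ} (x : Fin n × (Fin n × Harm m) → ℂ) :
    Fin n × (Fin n × ℤ) → ℂ :=
  fun p => if h : p.2.2 ∈ Finset.Icc (-(m : ℤ)) m then x (p.1, (p.2.1, ⟨p.2.2, h⟩)) else 0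

/-- The matrix function whose phasors are given by a truncated column:
its `(i, j)` entry is `∑_{|k| ≤ m} x_{(j, (i, k))} e^{jωkt}`. -/
noncomputable def ofTruncPhasors {n m : ℕ} (T : ℝ) (x : Fin n × (Fin n × Harm m) → ℂ) :
    ℝ → Matrix (Fin n) (Fin n) ℂ :=
  fun t => Matrix.of fun i j => ∑ k : Harm m,
    x (j, (i, k)) * Complex.exp (Complex.I * (2 * Real.pi / T : ℝ) * ((k : ℤ) : ℂ) * t)

/-! ### Bounded operators on `ℓ²` and their matrices -/

section Ell2Operators

open Filter Topology

variable {ι κ : Type*}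

/-! The Sylvester matrix is `D + E`, with `D` diagonal with entries `d = -jωk - 1` and `E` bounded,
since Laurent operators with `L^∞` symbols are bounded. The family `d⁻¹` is bounded, tends to zero
and is square-summable; everything rests on these three facts.

Since `d⁻¹ → 0`, `D⁻¹` is a norm limit of its finite cuts `D_m⁻¹`, so `D⁻¹ E` is compact. By the
Fredholm alternative, `1 + D⁻¹ E` is invertible once `D + E` is injective, and `(1 + D⁻¹ E)⁻¹ D⁻¹`
is then the bounded inverse (`isBoundedInverse_of_diagonal_add`).

Injectivity comes from the spectral hypothesis. The columns of a solution of the homogeneous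
equation define a linear map from `ℂⁿ` to `ℓ²` that intertwines `Λ` with `𝒜 - 𝒩`. Unless it vanishes
on the generalized eigenspaces of `Λ`, an eigenvalue of `Λ` is also one of `𝒜 - 𝒩`, although it lies
in the spectrum of `Λ ⊗ ℐ - 𝒩` (`eq_zero_of_intertwining`, `eq_zero_of_sylvester_eq_zero`).

The truncated system is the equation `(1 + D_m⁻¹ E) u = D_m⁻¹ q`, and `1 + D_m⁻¹ E → 1 + D⁻¹ E` in
norm, so the truncated matrices are eventually invertible and their solutions converge in `ℓ²`. The
error is `d⁻¹` times a family tending to zero in `ℓ²`, so by Cauchy-Schwarz it also tends to zero in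
`ℓ¹` (`finite_section_method`). The `ℓ¹` norm of the phasors bounds the norm of the Toeplitz
operator (`exists_hasMatrix_of_summable`), which gives the convergence in operator norm. -/

theorem memℓp_two_iff {f : ι → ℂ} : Memℓp f 2 ↔ Summable fun i => ‖f i‖ ^ 2 := by
  rw [memℓp_gen_iff (by norm_num)]
  simp

theorem Ell2.norm_sq_eq_tsum (x : Ell2 ι) : ‖x‖ ^ 2 = ∑' i, ‖x i‖ ^ 2 := by
  have h := lp.norm_rpow_eq_tsum (p := 2) (by norm_num) x
  simpa using h

theorem Ell2.summable_norm_sq (x : Ell2 ι) : Summable fun i => ‖x i‖ ^ 2 :=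
  memℓp_two_iff.1 x.2

theorem Ell2.norm_le_of_tsum_le {x : Ell2 ι} {C : ℝ} (hC : 0 ≤ C)
    (h : ∑' i, ‖x i‖ ^ 2 ≤ C ^ 2) : ‖x‖ ≤ C := by
  rw [← Ell2.norm_sq_eq_tsum] at h
  exact (pow_le_pow_iff_left₀ (norm_nonneg _) hC two_ne_zero).1 h

theorem memℓp_mul_bounded {w : ι → ℂ} {C : ℝ} (hw : ∀ i, ‖w i‖ ≤ C) {x : ι → ℂ}
    (hx : Memℓp x 2) : Memℓp (fun i => w i * x i) 2 := by
  refine ((hx.norm).const_smul C).mono fun i => ?_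
  simp only [Pi.smul_apply, smul_eq_mul, norm_mul]
  gcongr
  exact hw i

/-- Multiplication by a bounded family, as a bounded operator on `ℓ²`. -/
noncomputable def mulOp (w : ι → ℂ) {C : ℝ} (hw : ∀ i, ‖w i‖ ≤ C) : Ell2 ι →L[ℂ] Ell2 ι :=
  LinearMap.mkContinuous
    { toFun := fun x => ⟨fun i => w i * x i, memℓp_mul_bounded hw x.2⟩
      map_add' := fun x y => by ext i; exact mul_add _ _ _
      map_smul' := fun c x => by ext i; simp [mul_left_comm] } |C| fun x => by
    refine Ell2.norm_le_of_tsum_le (by positivity) ?_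
    rw [mul_pow, Ell2.norm_sq_eq_tsum x, ← tsum_mul_left]
    refine Summable.tsum_le_tsum (fun i => ?_) (memℓp_two_iff.1 (memℓp_mul_bounded hw x.2))
      ((Ell2.summable_norm_sq x).mul_left _)
    simp only [LinearMap.coe_mk, AddHom.coe_mk, norm_mul, mul_pow]
    gcongr
    exact (hw i).trans (le_abs_self C)

@[simp]
theorem mulOp_apply (w : ι → ℂ) {C : ℝ} (hw : ∀ i, ‖w i‖ ≤ C) (x : Ell2 ι) (i : ι) :
    mulOp w hw x i = w i * x i := rfl

theorem norm_mulOp_le {w : ι → ℂ} {C : ℝ} (hw : ∀ i, ‖w i‖ ≤ C) : ‖mulOp w hw‖ ≤ |C| :=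
  LinearMap.mkContinuous_norm_le _ (abs_nonneg _) _

/-- Composition with an injective map of the index sets, as a bounded operator on `ℓ²`. -/
noncomputable def pullOp (f : ι → κ) (hf : f.Injective) : Ell2 κ →L[ℂ] Ell2 ι :=
  LinearMap.mkContinuous
    { toFun := fun x => ⟨fun i => x (f i),
        memℓp_two_iff.2 ((Ell2.summable_norm_sq x).comp_injective hf)⟩
      map_add' := fun x y => by ext i; rfl
      map_smul' := fun c x => by ext i; simp } 1 fun x => by
    refine Ell2.norm_le_of_tsum_le (by positivity) ?_
    rw [one_mul, Ell2.norm_sq_eq_tsum x]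
    exact tsum_comp_le_tsum_of_inj (Ell2.summable_norm_sq x) (fun _ => by positivity) hf

@[simp]
theorem pullOp_apply (f : ι → κ) (hf : f.Injective) (x : Ell2 κ) (i : ι) :
    pullOp f hf x i = x (f i) := rfl

theorem norm_pullOp_le (f : ι → κ) (hf : f.Injective) : ‖pullOp f hf‖ ≤ 1 :=
  LinearMap.mkContinuous_norm_le _ zero_le_one _

theorem norm_sq_extend (f : ι → κ) (x : ι → ℂ) :
    (fun k => ‖Function.extend f x 0 k‖ ^ 2) = Function.extend f (fun i => ‖x i‖ ^ 2) 0 := by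
  classical
  funext k
  by_cases h : ∃ i, f i = k <;> simp [Function.extend_def, h]

theorem memℓp_extend {f : ι → κ} (hf : f.Injective) {x : ι → ℂ} (hx : Memℓp x 2) :
    Memℓp (Function.extend f x 0) 2 := by
  rw [memℓp_two_iff] at hx ⊢
  rw [norm_sq_extend]
  exact ((hasSum_extend_zero hf).2 hx.hasSum).summable

/-- Extension by zero along an injective map of the index sets, as a bounded operator on `ℓ²`. -/
noncomputable def pushOp (f : ι → κ) (hf : f.Injective) : Ell2 ι →L[ℂ] Ell2 κ :=
  LinearMap.mkContinuous
    { toFun := fun x => ⟨Function.extend f x 0, memℓp_extend hf x.2⟩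
      map_add' := fun x y => by
        ext k
        change Function.extend f (x + y : ι → ℂ) 0 k =
          Function.extend f x 0 k + Function.extend f y 0 k
        rw [← add_zero (0 : κ → ℂ), Function.extend_add, add_zero, Pi.add_apply]
      map_smul' := fun c x => by
        ext k
        change Function.extend f (c • (x : ι → ℂ)) 0 k = c • Function.extend f x 0 k
        rw [← smul_zero (A := κ → ℂ) c, Function.extend_smul, smul_zero, Pi.smul_apply] } 1 fun x => by
    refine Ell2.norm_le_of_tsum_le (by positivity) ?_
    rw [one_mul, Ell2.norm_sq_eq_tsum x]
    change ∑' k, ‖Function.extend f x 0 k‖ ^ 2 ≤ _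
    rw [norm_sq_extend]
    exact ((hasSum_extend_zero hf).2 (Ell2.summable_norm_sq x).hasSum).tsum_eq.le

theorem pushOp_apply (f : ι → κ) (hf : f.Injective) (x : Ell2 ι) (k : κ) :
    pushOp f hf x k = Function.extend f x 0 k := rfl

@[simp]
theorem pushOp_apply_apply (f : ι → κ) (hf : f.Injective) (x : Ell2 ι) (i : ι) :
    pushOp f hf x (f i) = x i := by
  rw [pushOp_apply, hf.extend_apply]

theorem pushOp_apply_of_notMem (f : ι → κ) (hf : f.Injective) (x : Ell2 ι) {k : κ}
    (hk : ¬ ∃ i, f i = k) : pushOp f hf x k = 0 := by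
  rw [pushOp_apply, Function.extend_apply' _ _ _ hk, Pi.zero_apply]

theorem norm_pushOp_le (f : ι → κ) (hf : f.Injective) : ‖pushOp f hf‖ ≤ 1 :=
  LinearMap.mkContinuous_norm_le _ zero_le_one _

/-- An element of `ℓ²` is the norm-convergent sum of its coordinates times basis vectors, and `D`
followed by evaluation at `i` is continuous. -/
theorem hasMatrix_single [DecidableEq ι] (D : Ell2 ι →L[ℂ] Ell2 ι) :
    HasMatrix D fun i j => D (lp.single 2 j 1) i := by
  intro x i
  have h := (lp.hasSum_single (by norm_num) x).mapL
    ((lp.evalCLM ℂ (fun _ : ι => ℂ) 2 i).comp D)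
  have hx : ∀ j, ((lp.evalCLM ℂ (fun _ : ι => ℂ) 2 i).comp D) (lp.single 2 j (x j)) =
      D (lp.single 2 j 1) i * x j := by
    intro j
    have hj : lp.single 2 j (x j) = x j • lp.single (E := fun _ : ι => ℂ) 2 j 1 := by
      rw [← lp.single_smul, smul_eq_mul, mul_one]
    rw [hj, map_smul, smul_eq_mul, mul_comm]
    rfl
  simp only [hx] at h
  exact h

theorem hasMatrix_iff [DecidableEq ι] {D : Ell2 ι →L[ℂ] Ell2 ι} {M : Matrix ι ι ℂ} :
    HasMatrix D M ↔ ∀ i j, D (lp.single 2 j 1) i = M i j := by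
  constructor
  · intro h i j
    refine (h (lp.single 2 j 1) i).unique ?_
    convert hasSum_single j ?_ using 1
    · simp
    · intro k hk
      simp [hk]
  · intro h
    have : M = fun i j => D (lp.single 2 j 1) i := by
      ext i j
      exact (h i j).symm
    rw [this]
    exact hasMatrix_single D

/-- Multiplying by the invertible diagonal turns `(1 + D⁻¹ E) x = D⁻¹ y` into `M x = y`. The maximal
domain costs nothing: rows always converge by `hM`, and `M (R y) = y` is already in `ℓ²`. -/
theorem isBoundedInverse_of_diagonal_add {M : Matrix ι ι ℂ} {d : ι → ℂ} {C : ℝ}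
    {E F : Ell2 ι →L[ℂ] Ell2 ι} (hd : ∀ i, d i ≠ 0) (hC : ∀ i, ‖(d i)⁻¹‖ ≤ C)
    (hM : ∀ (x : Ell2 ι) i, HasSum (fun j => M i j * x j) (d i * x i + E x i))
    (hF : F * (1 + mulOp _ hC * E) = 1) (hF' : (1 + mulOp _ hC * E) * F = 1) :
    IsBoundedInverse (matrixOp M) (F * mulOp _ hC) := by
  have key : ∀ x y : Ell2 ι, (1 + mulOp _ hC * E) x = mulOp _ hC y ↔
      ∀ i, d i * x i + E x i = y i := by
    intro x y
    rw [lp.ext_iff, funext_iff]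
    refine forall_congr' fun i => ?_
    have h := hd i
    simp only [add_apply, one_apply_eq_self,
      mul_apply_eq_comp, lp.coeFn_add, Pi.add_apply, mulOp_apply]
    constructor
    · intro h1
      field_simp at h1
      linear_combination h1
    · intro h1
      field_simp
      linear_combination h1
  constructor
  · intro y
    have h1 : ∀ i, d i * (F * mulOp _ hC) y i + E ((F * mulOp _ hC) y) i = y i := by
      rw [← key]
      exact DFunLike.congr_fun hF' (mulOp _ hC y)
    have h2 : (fun i => ∑' j, M i j * (F * mulOp _ hC) y j) = y :=
      funext fun i => by rw [(hM _ i).tsum_eq, h1]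
    refine ⟨⟨fun i => (hM _ i).summable, ?_⟩, ?_⟩
    · rw [h2]
      exact y.2
    · ext i
      exact congrFun h2 i
  · intro x
    have h1 : (1 + mulOp _ hC * E) (x : Ell2 ι) = mulOp _ hC (matrixOp M x) := by
      rw [key]
      intro i
      exact (hM x i).tsum_eq.symm
    rw [mul_apply_eq_comp, ← h1, ← mul_apply_eq_comp, hF]
    rfl

end Ell2Operators

/-! ### Compactness and the finite section method -/

section FiniteSections

open Filter Topology

variable {ι : Type*}

/-- A finite family extended by zero to an element of `ℓ²`. -/
noncomputable def finExtend {κ : Type*} [Finite κ] (e : κ → ι) (z : κ → ℂ) : Ell2 ι :=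
  ⟨Function.extend e z 0, by
    refine Memℓp.of_exponent_ge (q := 0) (memℓp_zero ?_) (by simp)
    refine (Set.finite_range e).subset fun i hi => ?_
    by_contra h
    exact hi (Function.extend_apply' _ _ _ h)⟩

theorem finExtend_apply {κ : Type*} [Finite κ] {e : κ → ι} (he : e.Injective) (z : κ → ℂ) (k : κ) :
    finExtend e z (e k) = z k := he.extend_apply _ _ _

theorem finExtend_apply_of_notMem {κ : Type*} [Finite κ] (e : κ → ι) (z : κ → ℂ) {i : ι}
    (hi : ¬ ∃ k, e k = i) : finExtend e z i = 0 := Function.extend_apply' _ _ _ hi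

theorem summable_finExtend {κ : Type*} [Finite κ] (e : κ → ι) (z : κ → ℂ) :
    Summable fun i => finExtend e z i :=
  summable_of_hasFiniteSupport <| (Set.finite_range e).subset fun _ hi => by
    by_contra h
    exact hi (finExtend_apply_of_notMem e z h)

theorem hasSum_mul_finExtend {κ : Type*} [Fintype κ] {e : κ → ι} (he : e.Injective)
    (f : ι → ℂ) (z : κ → ℂ) :
    HasSum (fun i => f i * finExtend e z i) (∑ k, f (e k) * z k) := by
  rw [← he.hasSum_iff]
  · convert hasSum_fintype fun k => f (e k) * z k using 2 with k
    simp [finExtend_apply he]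
  · intro i hi
    rw [finExtend_apply_of_notMem e z hi, mul_zero]

theorem norm_cut_le {d : ι → ℂ} {C : ℝ} (hC : ∀ i, ‖(d i)⁻¹‖ ≤ C) (s : Set ι) (i : ι) :
    ‖s.indicator (fun i => (d i)⁻¹) i‖ ≤ C :=
  (norm_indicator_le_norm_self _ _).trans (hC i)

theorem norm_indicator_one_le (s : Set ι) (i : ι) : ‖s.indicator (1 : ι → ℂ) i‖ ≤ 1 :=
  (norm_indicator_le_norm_self _ _).trans (by simp)

/-- The cut factors through the finite-dimensional space `ℓ²(s)`. -/
theorem isCompactOperator_cut {d : ι → ℂ} {C : ℝ} (hC : ∀ i, ‖(d i)⁻¹‖ ≤ C) {s : Set ι}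
    (hs : s.Finite) : IsCompactOperator (mulOp _ (norm_cut_le hC s)) := by
  have := hs.to_subtype
  have h : mulOp _ (norm_cut_le hC s) =
      (pushOp ((↑) : s → ι) Subtype.val_injective ∘L pullOp _ Subtype.val_injective) ∘L
        mulOp _ (norm_cut_le hC s) := by
    ext x i
    by_cases hi : i ∈ s
    · exact (pushOp_apply_apply ((↑) : s → ι) Subtype.val_injective
        (pullOp _ Subtype.val_injective (mulOp _ (norm_cut_le hC s) x)) ⟨i, hi⟩).symm
    · rw [ContinuousLinearMap.comp_apply, ContinuousLinearMap.comp_apply,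
        pushOp_apply_of_notMem _ _ _ (by simpa using hi), mulOp_apply,
        Set.indicator_of_notMem hi, zero_mul]
  rw [h]
  have hfin : FiniteDimensional ℂ (Ell2 s) := by
    have := Fintype.ofFinite s
    exact (lpPiLpₗᵢ (p := 2) (fun _ : s => ℂ) ℂ).symm.toLinearEquiv.finiteDimensional
  have hid : IsCompactOperator (id : Ell2 s → Ell2 s) :=
    isCompactOperator_id_iff_finiteDimensional (𝕜 := ℂ).2 hfin
  exact ((hid.comp_clm (pullOp ((↑) : s → ι) Subtype.val_injective)).clm_comp
    (pushOp ((↑) : s → ι) Subtype.val_injective)).comp_clm (mulOp _ (norm_cut_le hC s))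

theorem norm_mulOp_sub_cut_le {d : ι → ℂ} {C δ : ℝ} (hC : ∀ i, ‖(d i)⁻¹‖ ≤ C) {s : Set ι}
    (hδ : 0 ≤ δ) (h : ∀ i ∉ s, ‖(d i)⁻¹‖ ≤ δ) :
    ‖mulOp _ hC - mulOp _ (norm_cut_le hC s)‖ ≤ δ := by
  have hw : ∀ i, ‖sᶜ.indicator (fun i => (d i)⁻¹) i‖ ≤ δ := by
    intro i
    by_cases hi : i ∈ s
    · simpa [hi] using hδ
    · simpa [hi] using h i hi
  have heq : mulOp _ hC - mulOp _ (norm_cut_le hC s) = mulOp _ hw := by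
    ext x i
    by_cases hi : i ∈ s <;> simp [hi]
  rw [heq]
  exact (norm_mulOp_le hw).trans (abs_of_nonneg hδ).le

theorem tendsto_cut {d : ι → ℂ} {C : ℝ} (hC : ∀ i, ‖(d i)⁻¹‖ ≤ C) {s : ℕ → Set ι} {δ : ℕ → ℝ}
    (hδ : Tendsto δ atTop (𝓝 0)) (hδ0 : ∀ m, 0 ≤ δ m) (h : ∀ m, ∀ i ∉ s m, ‖(d i)⁻¹‖ ≤ δ m) :
    Tendsto (fun m => mulOp _ (norm_cut_le hC (s m))) atTop (𝓝 (mulOp _ hC)) := by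
  rw [tendsto_iff_norm_sub_tendsto_zero]
  refine squeeze_zero (fun _ => norm_nonneg _) (fun m => ?_) hδ
  rw [norm_sub_rev]
  exact norm_mulOp_sub_cut_le hC (hδ0 m) (h m)

/-- Fredholm alternative: the nonzero number `-1` is either an eigenvalue of `K` or in its resolvent
set. -/
theorem isUnit_one_add_of_isCompactOperator {X : Type*} [NormedAddCommGroup X] [NormedSpace ℂ X]
    [CompleteSpace X] {K : X →L[ℂ] X} (hK : IsCompactOperator K)
    (hinj : ∀ x, x + K x = 0 → x = 0) : IsUnit (1 + K) := by
  rcases hK.hasEigenvalue_or_mem_resolventSet (μ := (-1 : ℂ)) (by simp) with h | h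
  · obtain ⟨x, hx, hx0⟩ := h.exists_hasEigenvector
    refine absurd (hinj x ?_) hx0
    have := Module.End.mem_eigenspace_iff.1 hx
    simp only [ContinuousLinearMap.coe_coe, neg_smul, one_smul] at this
    rw [this, add_neg_cancel]
  · rw [spectrum.mem_resolventSet_iff] at h
    have h2 := h.neg
    simpa [add_comm] using h2

/-- The finite section of the equation `(1 + D⁻¹ E) x = D⁻¹ y`. -/
theorem one_add_cut_finExtend {κ : Type*} [Fintype κ] {e : κ → ι} (he : e.Injective)
    {M : Matrix ι ι ℂ} {d : ι → ℂ} {C : ℝ} {E : Ell2 ι →L[ℂ] Ell2 ι} (hd : ∀ i, d i ≠ 0)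
    (hC : ∀ i, ‖(d i)⁻¹‖ ≤ C)
    (hM : ∀ (x : Ell2 ι) i, HasSum (fun j => M i j * x j) (d i * x i + E x i)) (z : κ → ℂ) :
    (1 + mulOp _ (norm_cut_le hC (Set.range e)) * E) (finExtend e z) =
      mulOp _ (norm_cut_le hC (Set.range e)) (finExtend e ((M.submatrix e e).mulVec z)) := by
  ext i
  simp only [add_apply, one_apply_eq_self, mul_apply_eq_comp, lp.coeFn_add, Pi.add_apply,
    mulOp_apply]
  by_cases hi : i ∈ Set.range e
  · obtain ⟨k, rfl⟩ := hi
    have h1 := (hM (finExtend e z) (e k)).unique (hasSum_mul_finExtend he _ z)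
    have h2 : (M.submatrix e e).mulVec z k = ∑ l, M (e k) (e l) * z l := rfl
    rw [Set.indicator_of_mem (Set.mem_range_self k), finExtend_apply he, finExtend_apply he, h2,
      ← h1, finExtend_apply he]
    have := hd (e k)
    field_simp
  · rw [Set.indicator_of_notMem hi, finExtend_apply_of_notMem e z hi]
    simp

/-- A kernel vector of the finite section, extended by zero, is killed by `1 + D_m⁻¹ E`. -/
theorem isUnit_det_of_isUnit_one_add {κ : Type*} [Fintype κ] [DecidableEq κ] {e : κ → ι}
    (he : e.Injective) {M : Matrix ι ι ℂ} {d : ι → ℂ} {C : ℝ} {E : Ell2 ι →L[ℂ] Ell2 ι}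
    (hd : ∀ i, d i ≠ 0) (hC : ∀ i, ‖(d i)⁻¹‖ ≤ C)
    (hM : ∀ (x : Ell2 ι) i, HasSum (fun j => M i j * x j) (d i * x i + E x i))
    (hU : IsUnit (1 + mulOp _ (norm_cut_le hC (Set.range e)) * E)) :
    IsUnit (M.submatrix e e).det := by
  rw [← Matrix.isUnit_iff_isUnit_det, ← Matrix.mulVec_injective_iff_isUnit,
    ← Matrix.coe_mulVecLin, injective_iff_map_eq_zero]
  intro z hz
  rw [Matrix.mulVecLin_apply] at hz
  obtain ⟨u, hu⟩ := hU
  have h1 := one_add_cut_finExtend he hd hC hM z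
  have h0 : finExtend e (0 : κ → ℂ) = 0 := by
    ext i
    exact congrFun (Function.extend_zero e) i
  rw [hz, h0, map_zero] at h1
  have h2 : finExtend e z = 0 := by
    have : (↑u⁻¹ * (↑u : Ell2 ι →L[ℂ] Ell2 ι)) (finExtend e z) = 0 := by
      rw [mul_apply_eq_comp, hu, h1, map_zero]
    simpa using this
  ext k
  rw [← finExtend_apply he z k, h2]
  rfl

theorem finExtend_eq_cut {κ : Type*} [Fintype κ] {e : κ → ι} (he : e.Injective) {d : ι → ℂ} {C : ℝ}
    (hC : ∀ i, ‖(d i)⁻¹‖ ≤ C) (q : Ell2 ι) :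
    mulOp _ (norm_cut_le hC (Set.range e)) (finExtend e fun k => q (e k)) =
      mulOp _ (norm_cut_le hC (Set.range e)) q := by
  ext i
  simp only [mulOp_apply]
  by_cases hi : i ∈ Set.range e
  · obtain ⟨k, rfl⟩ := hi
    rw [finExtend_apply he]
  · rw [Set.indicator_of_notMem hi, zero_mul, zero_mul]

/-- The projections onto an exhausting sequence of index sets converge strongly to the identity. -/
theorem tendsto_indicator_one {s : ℕ → Set ι} (hs : ∀ i, ∀ᶠ m in atTop, i ∈ s m) (g : Ell2 ι) :
    Tendsto (fun m => mulOp _ (norm_indicator_one_le (s m)) g) atTop (𝓝 g) := by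
  classical
  rw [tendsto_iff_norm_sub_tendsto_zero]
  -- Dominated convergence for the squared norm: each coordinate of the difference is eventually
  -- zero and is bounded by that of `g`.
  have h : Tendsto (fun m => ∑' i, ‖(mulOp _ (norm_indicator_one_le (s m)) g - g) i‖ ^ 2) atTop
      (𝓝 (∑' _ : ι, (0 : ℝ))) := by
    refine tendsto_tsum_of_dominated_convergence (Ell2.summable_norm_sq g) (fun i => ?_)
      (Eventually.of_forall fun m i => ?_)
    · refine tendsto_const_nhds.congr' ?_
      filter_upwards [hs i] with m hm
      simp [hm]
    · by_cases hi : i ∈ s m <;> simp [hi]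
  simp only [← Ell2.norm_sq_eq_tsum, tsum_zero] at h
  have h2 := h.sqrt
  simpa using h2

/-- Cauchy-Schwarz applied to `x = d⁻¹ g`; this turns `ℓ²` control of `g` into `ℓ¹` control of `x`.
-/
theorem tsum_norm_le_of_mul_eq {d : ι → ℂ} (hd : ∀ i, d i ≠ 0)
    (hs : Memℓp (fun i => (d i)⁻¹) 2) {x : ι → ℂ} {g : Ell2 ι} (h : ∀ i, d i * x i = g i) :
    (Summable fun i => ‖x i‖) ∧ ∑' i, ‖x i‖ ≤ ‖(⟨_, hs⟩ : Ell2 ι)‖ * ‖g‖ := by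
  have h1 := lp.tsum_mul_le_mul_norm (p := 2) (q := 2)
    (by simpa using Real.HolderConjugate.two_two) (⟨_, hs⟩ : Ell2 ι) g
  have h2 : ∀ i, ‖(d i)⁻¹‖ * ‖g i‖ = ‖x i‖ := by
    intro i
    rw [← h, ← norm_mul, inv_mul_cancel_left₀ (hd i)]
  simpa only [h2] using h1

/-- The finite section method for the sum of a diagonal matrix whose inverse is square-summable
and of a bounded operator: if the sum is injective, it has a bounded inverse, the finite sections
are eventually invertible, and their solutions converge in `ℓ²` and in `ℓ¹`. -/
theorem finite_section_method {κ : ℕ → Type*} [∀ m, Fintype (κ m)] [∀ m, DecidableEq (κ m)]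
    {e : ∀ m, κ m → ι} (he : ∀ m, (e m).Injective) {M : Matrix ι ι ℂ} {d : ι → ℂ} {C : ℝ}
    {E : Ell2 ι →L[ℂ] Ell2 ι} (hd : ∀ i, d i ≠ 0) (hC : ∀ i, ‖(d i)⁻¹‖ ≤ C)
    (hM : ∀ (x : Ell2 ι) i, HasSum (fun j => M i j * x j) (d i * x i + E x i))
    {δ : ℕ → ℝ} (hδ : Tendsto δ atTop (𝓝 0)) (hδ0 : ∀ m, 0 ≤ δ m)
    (h : ∀ m, ∀ i ∉ Set.range (e m), ‖(d i)⁻¹‖ ≤ δ m) (hs : Memℓp (fun i => (d i)⁻¹) 2)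
    (hinj : ∀ x : Ell2 ι, (∀ i, d i * x i + E x i = 0) → x = 0) :
    ∃ R : Ell2 ι →L[ℂ] Ell2 ι, IsBoundedInverse (matrixOp M) R ∧
      (∀ᶠ m in atTop, IsUnit (M.submatrix (e m) (e m)).det) ∧
      ∀ q : Ell2 ι, (Summable fun i => ‖R q i‖) ∧
        ∀ u : ℕ → Ell2 ι, (∀ m, u m = finExtend (e m)
          ((M.submatrix (e m) (e m))⁻¹.mulVec fun k => q (e m k))) →
        Tendsto u atTop (𝓝 (R q)) ∧ (∀ m, Summable fun i => ‖R q i - u m i‖) ∧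
          Tendsto (fun m => ∑' i, ‖R q i - u m i‖) atTop (𝓝 0) := by
  have hcut := tendsto_cut hC hδ hδ0 h
  have hK : IsCompactOperator (mulOp _ hC * E) :=
    (isCompactOperator_of_tendsto hcut (Eventually.of_forall fun m =>
      isCompactOperator_cut hC (Set.finite_range (e m)))).comp_clm E
  have hU : IsUnit (1 + mulOp _ hC * E) := by
    refine isUnit_one_add_of_isCompactOperator hK fun x hx => hinj x fun i => ?_
    have h1 := congrArg (fun y : Ell2 ι => d i * y i) hx
    have := hd i
    simpa [mul_add, mul_inv_cancel_left₀ this] using h1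
  obtain ⟨U, hU⟩ := hU
  have hlim : Tendsto (fun m => 1 + mulOp _ (norm_cut_le hC (Set.range (e m))) * E) atTop
      (𝓝 (U : Ell2 ι →L[ℂ] Ell2 ι)) := by
    rw [hU]
    exact (hcut.mul_const E).const_add 1
  have hunit : ∀ᶠ m in atTop,
      IsUnit (1 + mulOp _ (norm_cut_le hC (Set.range (e m))) * E) :=
    hlim.eventually (Units.isOpen.mem_nhds U.isUnit)
  have hdet : ∀ᶠ m in atTop, IsUnit (M.submatrix (e m) (e m)).det :=
    hunit.mono fun m hm => isUnit_det_of_isUnit_one_add (he m) hd hC hM hm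
  -- An index outside the section satisfies `‖(d i)⁻¹‖ ≤ δ m`, which fails as soon as `δ m` drops
  -- below this positive number.
  have hexh : ∀ i, ∀ᶠ m in atTop, i ∈ Set.range (e m) := by
    intro i
    have hpos : 0 < ‖(d i)⁻¹‖ := norm_pos_iff.2 (inv_ne_zero (hd i))
    filter_upwards [hδ.eventually (gt_mem_nhds hpos)] with m hm
    by_contra hi
    exact absurd (h m i hi) (not_le.2 hm)
  have hR := isBoundedInverse_of_diagonal_add (F := (↑U⁻¹ : Ell2 ι →L[ℂ] Ell2 ι)) hd hC hM
    (by rw [← hU]; exact U.inv_mul) (by rw [← hU]; exact U.mul_inv)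
  refine ⟨_, hR, hdet, fun q => ?_⟩
  set x : Ell2 ι := (↑U⁻¹ * mulOp _ hC : Ell2 ι →L[ℂ] Ell2 ι) q with hxdef
  have hx : ∀ i, d i * x i = (q - E x) i := by
    intro i
    obtain ⟨hy, hLy⟩ := hR.1 q
    have h1 : ∑' j, M i j * x j = q i := congrArg (fun y : Ell2 ι => y i) hLy
    rw [(hM x i).tsum_eq] at h1
    rw [lp.coeFn_sub, Pi.sub_apply, ← h1]
    ring
  refine ⟨(tsum_norm_le_of_mul_eq hd hs hx).1, fun u hu => ?_⟩
  have hsol : ∀ᶠ m in atTop, (1 + mulOp _ (norm_cut_le hC (Set.range (e m))) * E) (u m) =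
      mulOp _ (norm_cut_le hC (Set.range (e m))) q := by
    filter_upwards [hdet] with m hm
    rw [hu, one_add_cut_finExtend (he m) hd hC hM, Matrix.mulVec_mulVec,
      Matrix.mul_nonsing_inv _ hm, Matrix.one_mulVec, finExtend_eq_cut (he m) hC]
  -- Inversion is continuous at a unit, so the inverses of the cut operators converge in norm.
  have hux : Tendsto u atTop (𝓝 x) := by
    have h1 : Tendsto (fun m =>
        Ring.inverse (1 + mulOp _ (norm_cut_le hC (Set.range (e m))) * E) *
          mulOp _ (norm_cut_le hC (Set.range (e m)))) atTop
        (𝓝 (↑U⁻¹ * mulOp _ hC : Ell2 ι →L[ℂ] Ell2 ι)) := by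
      rw [← Ring.inverse_unit]
      exact ((NormedRing.inverse_continuousAt U).tendsto.comp hlim).mul hcut
    have h2 := (((ContinuousLinearMap.apply ℂ (Ell2 ι) q).continuous.tendsto _).comp h1)
    refine h2.congr' ?_
    filter_upwards [hsol, hunit] with m hm1 hm2
    simp only [Function.comp_apply, ContinuousLinearMap.apply_apply, mul_apply_eq_comp]
    rw [← hm1, ← mul_apply_eq_comp, Ring.inverse_mul_cancel _ hm2]
    rfl
  refine ⟨hux, fun m => ?_, ?_⟩
  · rw [hu]
    exact ((tsum_norm_le_of_mul_eq hd hs hx).1.of_norm.sub (summable_finExtend _ _)).norm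
  -- On the section `d u = q - E u`, and off it `u = 0`; hence `g = d (x - u)` as soon as the
  -- section is invertible.
  set g : ℕ → Ell2 ι := fun m => (q - E x) -
    mulOp _ (norm_indicator_one_le (Set.range (e m))) (q - E (u m)) with hg
  have hgx : ∀ᶠ m in atTop, ∀ i, d i * (x i - u m i) = g m i := by
    filter_upwards [hsol] with m hm i
    have h1 := congrArg (fun y : Ell2 ι => d i * y i) hm
    simp only [add_apply, one_apply_eq_self, mul_apply_eq_comp, lp.coeFn_add, Pi.add_apply,
      mulOp_apply] at h1
    simp only [hg, lp.coeFn_sub, Pi.sub_apply, mulOp_apply, mul_sub, hx]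
    have := hd i
    by_cases hi : i ∈ Set.range (e m)
    · simp only [Set.indicator_of_mem hi, Pi.one_apply, one_mul] at h1 ⊢
      field_simp at h1
      linear_combination -h1
    · simp only [Set.indicator_of_notMem hi, zero_mul] at h1 ⊢
      linear_combination -h1
  -- With `P` the projection onto the section, `g = (1 - P)(q - E x) + P E (u - x)`: the first term
  -- vanishes by strong convergence, the second by `u → x`.
  have hg0 : Tendsto g atTop (𝓝 0) := by
    have h1 : Tendsto (fun m => mulOp _ (norm_indicator_one_le (Set.range (e m))) (E (u m - x)))
        atTop (𝓝 0) := by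
      have h2 : Tendsto (fun m => ‖E (u m - x)‖) atTop (𝓝 0) := by
        have h3 := (E.continuous.tendsto _).comp (hux.sub_const x)
        simpa using h3.norm
      refine squeeze_zero_norm (fun m => ?_) h2
      refine (ContinuousLinearMap.le_of_opNorm_le _ (norm_mulOp_le _) _).trans ?_
      simp
    have h4 := ((tendsto_const_nhds (x := q - E x)).sub
      (tendsto_indicator_one hexh (q - E x))).add h1
    rw [sub_self, add_zero] at h4
    refine h4.congr fun m => ?_
    simp only [hg, map_sub]
    abel
  have hb : Tendsto (fun m => ‖(⟨_, hs⟩ : Ell2 ι)‖ * ‖g m‖) atTop (𝓝 0) := by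
    simpa using hg0.norm.const_mul ‖(⟨_, hs⟩ : Ell2 ι)‖
  refine squeeze_zero' (Eventually.of_forall fun m => tsum_nonneg fun _ => norm_nonneg _) ?_ hb
  filter_upwards [hgx] with m hm
  exact (tsum_norm_le_of_mul_eq hd hs hm).2

end FiniteSections

/-! ### Phasors as Fourier coefficients; Laurent operators -/

section Phasors

variable {T : ℝ}

theorem phasor_eq (f : ℝ → ℂ) (k : ℤ) :
    phasor T f k = (1 / T : ℂ) * ∫ τ in (0 : ℝ)..T,
      f τ * Complex.exp (-(Complex.I * (2 * Real.pi / T : ℝ) * k * τ)) := by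
  rw [phasor, slidingPhasor, sub_self]

theorem fourier_neg_coe [ Fact (0 < T)] (k : ℤ) (τ : ℝ) :
    fourier (-k) (τ : AddCircle T) =
      Complex.exp (-(Complex.I * (2 * Real.pi / T : ℝ) * k * τ)) := by
  rw [fourier_coe_apply]
  congr 1
  push_cast
  ring

theorem phasor_comp_coe [ Fact (0 < T)] (g : AddCircle T → ℂ) (k : ℤ) :
    phasor T (fun t => g t) k = fourierCoeff g k := by
  rw [phasor_eq, fourierCoeff_eq_intervalIntegral g k 0, zero_add, Complex.real_smul]
  simp only [fourier_neg_coe, smul_eq_mul, mul_comm (g _)]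
  push_cast
  rfl

theorem phasor_eq_fourierCoeff [hT : Fact (0 < T)] (f : ℝ → ℂ) (k : ℤ) :
    phasor T f k = fourierCoeff (AddCircle.liftIoc T 0 f) k := by
  rw [phasor_eq, fourierCoeff_eq_intervalIntegral _ k 0, zero_add, Complex.real_smul]
  push_cast
  congr 1
  refine intervalIntegral.integral_congr_ae (Filter.Eventually.of_forall fun t ht => ?_)
  rw [Set.uIoc_of_le hT.out.le] at ht
  rw [AddCircle.liftIoc_coe_apply (by rwa [zero_add]), fourier_neg_coe, smul_eq_mul, mul_comm]
  push_cast
  rfl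

theorem memLp_liftIoc [ Fact (0 < T)] {f : ℝ → ℂ} {p : ℝ≥0∞}
    (hf : MemLp f p (volume.restrict (Set.Icc 0 T))) :
    MemLp (AddCircle.liftIoc T 0 f) p AddCircle.haarAddCircle := by
  rw [memLp_haarAddCircle_iff]
  apply MemLp.memLp_liftIoc
  rwa [zero_add, Measure.restrict_congr_set Ioc_ae_eq_Icc]

/-- The phasors of a function of class `L²` on a period, as an element of `ℓ²`. -/
theorem exists_phasor_eq_of_memLp (hT : 0 < T) {f : ℝ → ℂ}
    (hf : MemLp f 2 (volume.restrict (Set.Icc 0 T))) :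
    ∃ x : Ell2 ℤ, ∀ k, x k = phasor T f k := by
  have : Fact (0 < T) := ⟨hT⟩
  refine ⟨fourierBasis.repr ((memLp_liftIoc hf).toLp _), fun k => ?_⟩
  rw [fourierBasis_repr, phasor_eq_fourierCoeff, fourierCoeff_congr_ae (MemLp.coeFn_toLp _)]

/-- Riesz-Fischer: square-summable families are phasors of functions of class `L²`. -/
theorem exists_periodic_memLp_phasor_eq (hT : 0 < T) (x : Ell2 ℤ) :
    ∃ f : ℝ → ℂ, Function.Periodic f T ∧ MemLp f 2 (volume.restrict (Set.Icc 0 T)) ∧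
      ∀ k, phasor T f k = x k := by
  have : Fact (0 < T) := ⟨hT⟩
  set g := (fourierBasis (T := T)).repr.symm x with hg
  refine ⟨fun t => g (t : AddCircle T), fun t => ?_, ?_, fun k => ?_⟩
  · simp
  · have h1 : MemLp g 2 (volume : Measure (AddCircle T)) := (Lp.memLp g).of_haarAddCircle
    have h2 := h1.comp_measurePreserving (AddCircle.measurePreserving_mk T 0)
    rwa [zero_add, Measure.restrict_congr_set Ioc_ae_eq_Icc] at h2
  · rw [phasor_comp_coe g, ← fourierBasis_repr, hg, LinearIsometryEquiv.apply_symm_apply]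

/-- The Laurent operator of a bounded measurable function. -/
theorem exists_laurent (hT : 0 < T) {f : ℝ → ℂ}
    (hf : MemLp f ∞ (volume.restrict (Set.Icc 0 T))) :
    ∃ L : Ell2 ℤ →L[ℂ] Ell2 ℤ, ∀ k l, L (lp.single 2 l 1) k = phasor T f (k - l) := by
  have : Fact (0 < T) := ⟨hT⟩
  set φ := (memLp_liftIoc hf).toLp _ with hφ
  -- Multiplication by the symbol on `L²` of the circle; the Laurent operator is its conjugate by
  -- the Fourier basis.
  set m : Lp ℂ 2 (@AddCircle.haarAddCircle T _) →L[ℂ] Lp ℂ 2 (@AddCircle.haarAddCircle T _) :=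
    (ContinuousLinearMap.mul ℂ ℂ).holderL AddCircle.haarAddCircle ∞ 2 2 φ with hm
  refine ⟨(fourierBasis (T := T)).repr.toContinuousLinearEquiv.toContinuousLinearMap ∘L m ∘L
    (fourierBasis (T := T)).repr.symm.toContinuousLinearEquiv.toContinuousLinearMap, fun k l => ?_⟩
  have h1 : fourierBasis.repr.symm (lp.single 2 l (1 : ℂ)) = @fourierLp T _ 2 _ l := by
    rw [fourierBasis.repr_symm_single, coe_fourierBasis]
  change fourierBasis.repr (m (fourierBasis.repr.symm (lp.single 2 l (1 : ℂ)))) k = _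
  rw [h1, fourierBasis_repr, phasor_eq_fourierCoeff]
  refine integral_congr_ae ?_
  filter_upwards [(ContinuousLinearMap.mul ℂ ℂ).coeFn_holder (r := 2) φ (@fourierLp T _ 2 _ l),
    coeFn_fourierLp (T := T) 2 l, (memLp_liftIoc hf).coeFn_toLp] with t h2 h3 h4
  change _ • ((ContinuousLinearMap.mul ℂ ℂ).holder 2 φ (@fourierLp T _ 2 _ l)) t = _
  rw [h2, h3, h4, ContinuousLinearMap.mul_apply', smul_eq_mul, smul_eq_mul,
    show -(k - l) = -k + l by ring, fourier_add]
  ring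

theorem phasor_trigPolynomial (hT : 0 < T) {κ : Type*} [Fintype κ] (h : κ → ℤ)
    (c : κ → ℂ) (k : ℤ) :
    phasor T (fun t : ℝ => ∑ l, c l *
        Complex.exp (Complex.I * (2 * Real.pi / T : ℝ) * (h l : ℂ) * t)) k =
      ∑ l, if h l = k then c l else 0 := by
  have : Fact (0 < T) := ⟨hT⟩
  have h1 : (fun t : ℝ => ∑ l, c l *
        Complex.exp (Complex.I * (2 * Real.pi / T : ℝ) * (h l : ℂ) * t)) =
      fun t : ℝ => (∑ l, c l • (fourier (h l) : AddCircle T → ℂ)) (t : AddCircle T) := by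
    funext t
    rw [Finset.sum_apply]
    refine Finset.sum_congr rfl fun l _ => ?_
    rw [Pi.smul_apply, smul_eq_mul, fourier_coe_apply]
    congr 2
    push_cast
    ring
  rw [h1, phasor_comp_coe, fourierCoeff.sum, Finset.sum_apply]
  · refine Finset.sum_congr rfl fun l _ => ?_
    rw [fourierCoeff.const_smul, fourierCoeff_fourier, smul_eq_mul, Pi.single_apply]
    simp [eq_comm]
  · intro l _
    exact (((fourier (h l)).continuous.integrable_of_hasCompactSupport
      (HasCompactSupport.of_compactSpace _))).smul (c l)

end Phasors

/-! ### Block operators and block Toeplitz matrices -/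

section BlockOperators

variable {ι κ : Type*}

theorem pushOp_mk_apply [DecidableEq ι] (a : ι) (x : Ell2 κ) (p : ι × κ) :
    pushOp (Prod.mk a) (Prod.mk_right_injective a) x p = if p.1 = a then x p.2 else 0 := by
  obtain ⟨a', k⟩ := p
  split_ifs with h
  · obtain rfl : a' = a := h
    exact pushOp_apply_apply _ _ _ _
  · refine pushOp_apply_of_notMem _ _ _ ?_
    rintro ⟨k', hk⟩
    exact h (congrArg Prod.fst hk).symm

theorem pullOp_mk_single [DecidableEq ι] [DecidableEq κ] (b : ι) (q : ι × κ) :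
    pullOp (Prod.mk b) (Prod.mk_right_injective b) (lp.single 2 q (1 : ℂ)) =
      if b = q.1 then lp.single 2 q.2 (1 : ℂ) else 0 := by
  obtain ⟨b', l⟩ := q
  ext k
  by_cases h : b = b'
  · subst h
    simp [Pi.single_apply]
  · simp [h]

/-- The operator on `ℓ²` with the bounded operators `L a b` as blocks. -/
noncomputable def blockOp [Fintype ι] (L : ι → ι → Ell2 κ →L[ℂ] Ell2 κ) :
    Ell2 (ι × κ) →L[ℂ] Ell2 (ι × κ) :=
  ∑ a, ∑ b, pushOp (Prod.mk a) (Prod.mk_right_injective a) ∘L L a b ∘L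
    pullOp (Prod.mk b) (Prod.mk_right_injective b)

theorem blockOp_apply [Fintype ι] (L : ι → ι → Ell2 κ →L[ℂ] Ell2 κ) (x : Ell2 (ι × κ))
    (p : ι × κ) :
    blockOp L x p = ∑ b, L p.1 b (pullOp (Prod.mk b) (Prod.mk_right_injective b) x) p.2 := by
  classical
  simp only [blockOp, sum_apply, ContinuousLinearMap.comp_apply,
    lp.coeFn_sum, Finset.sum_apply, pushOp_mk_apply]
  rw [Finset.sum_comm]
  simp

theorem blockOp_single [Fintype ι] [DecidableEq ι] [DecidableEq κ]
    (L : ι → ι → Ell2 κ →L[ℂ] Ell2 κ) (p q : ι × κ) :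
    blockOp L (lp.single 2 q 1) p = L p.1 q.1 (lp.single 2 q.2 1) p.2 := by
  rw [blockOp_apply, Finset.sum_eq_single q.1]
  · rw [pullOp_mk_single, if_pos rfl]
  · intro b _ hb
    rw [pullOp_mk_single, if_neg hb, map_zero]
    rfl
  · simp

theorem hasSum_diagonal_add [DecidableEq ι] {E : Ell2 ι →L[ℂ] Ell2 ι} {M N : Matrix ι ι ℂ}
    {d : ι → ℂ} (hE : HasMatrix E N) (hM : M = Matrix.diagonal d + N) (x : Ell2 ι) (i : ι) :
    HasSum (fun j => M i j * x j) (d i * x i + E x i) := by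
  have h : HasSum (fun j => Matrix.diagonal d i j * x j) (d i * x i) := by
    convert hasSum_single i ?_ using 1
    · simp
    · intro j hj
      simp [Matrix.diagonal_apply_ne _ hj.symm]
  simpa only [hM, Matrix.add_apply, add_mul] using h.add (hE x i)

theorem exists_hasMatrix_blockToeplitz {n : ℕ} {T : ℝ} (hT : 0 < T)
    {A : ℝ → Matrix (Fin n) (Fin n) ℂ} (hA : PeriodicLp ∞ T A) :
    ∃ E : Ell2 (Fin n × ℤ) →L[ℂ] Ell2 (Fin n × ℤ), HasMatrix E (blockToeplitz T A) := by
  choose L hL using fun a b => exists_laurent hT (hA.2 a b)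
  refine ⟨blockOp L, hasMatrix_iff.2 fun p q => ?_⟩
  rw [blockOp_single, hL]
  rfl

/-- A block Toeplitz matrix with absolutely summable symbols defines a bounded operator, whose
norm is at most the sum of the absolute values of the symbols. -/
theorem exists_hasMatrix_of_summable {n : ℕ} {c : Fin n × (Fin n × ℤ) → ℂ}
    (hc : Summable fun p => ‖c p‖) :
    ∃ D : Ell2 (Fin n × ℤ) →L[ℂ] Ell2 (Fin n × ℤ),
      HasMatrix D (Matrix.of fun p q => c (q.1, (p.1, p.2 - q.2))) ∧ ‖D‖ ≤ ∑' p, ‖c p‖ := by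
  have hinj : ∀ p : Fin n × (Fin n × ℤ), (fun l : ℤ => (p.1, l - p.2.2)).Injective :=
    fun p l l' h => by simpa using h
  -- `V (b, a, k)` carries block `b` to block `a` and shifts harmonics by `k`. It is a contraction,
  -- so the operator is an absolutely convergent series of weighted shifts.
  set V : Fin n × (Fin n × ℤ) → Ell2 (Fin n × ℤ) →L[ℂ] Ell2 (Fin n × ℤ) := fun p =>
    pushOp (Prod.mk p.2.1) (Prod.mk_right_injective p.2.1) ∘L pullOp _ (hinj p) with hV
  have hnorm : ∀ p, ‖c p • V p‖ ≤ ‖c p‖ := by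
    intro p
    rw [norm_smul]
    refine mul_le_of_le_one_right (norm_nonneg _) ?_
    refine (ContinuousLinearMap.opNorm_comp_le _ _).trans ?_
    exact mul_le_one₀ (norm_pushOp_le _ _) (norm_nonneg _) (norm_pullOp_le _ _)
  have hsum : Summable fun p => c p • V p := Summable.of_norm_bounded hc hnorm
  refine ⟨∑' p, c p • V p, hasMatrix_iff.2 fun i q => ?_, tsum_of_norm_bounded hc.hasSum hnorm⟩
  have h1 := (hsum.hasSum.mapL (ContinuousLinearMap.apply ℂ (Ell2 (Fin n × ℤ))
    (lp.single 2 q 1))).mapL (lp.evalCLM ℂ (fun _ : Fin n × ℤ => ℂ) 2 i)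
  have h2 : ∀ p, lp.evalCLM ℂ (fun _ : Fin n × ℤ => ℂ) 2 i (ContinuousLinearMap.apply ℂ
      (Ell2 (Fin n × ℤ)) (lp.single 2 q 1) (c p • V p)) =
      c p * if p = (q.1, (i.1, i.2 - q.2)) then 1 else 0 := by
    rintro ⟨b, a, k⟩
    change c (b, a, k) * (V (b, a, k) (lp.single 2 q 1)) i = _
    simp only [hV, ContinuousLinearMap.comp_apply, pushOp_mk_apply, pullOp_apply]
    obtain ⟨b', l⟩ := q
    congr 1
    rw [lp.coeFn_single, Pi.single_apply, ← ite_and]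
    refine if_congr ?_ rfl rfl
    simp only [Prod.mk.injEq]
    constructor
    · rintro ⟨h1, h2, h3⟩
      exact ⟨h2, h1.symm, by omega⟩
    · rintro ⟨h2, h1, h3⟩
      exact ⟨h1.symm, h2, by omega⟩
  simp only [h2] at h1
  have h3 := h1.unique (hasSum_single (q.1, (i.1, i.2 - q.2)) fun p hp => by rw [if_neg hp, mul_zero])
  rw [if_pos rfl, mul_one] at h3
  exact h3

theorem summable_prod_of_finite [Finite ι] {f : ι × κ → ℝ} (hf : ∀ p, 0 ≤ f p)
    (h : ∀ a, Summable fun k => f (a, k)) : Summable f := by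
  have := Fintype.ofFinite ι
  exact (summable_prod_of_nonneg hf).2 ⟨h, (hasSum_fintype _).summable⟩

end BlockOperators

/-! ### Spectra, intertwining, and the splitting of the Sylvester matrix -/

section HarmonicSylvester

open Filter Topology

variable {n : ℕ} {T : ℝ}

theorem harmonicN_eq_diagonal {κ : Type} [DecidableEq κ] (h : κ → ℤ) :
    harmonicN n T h =
      Matrix.diagonal fun p => Complex.I * (2 * Real.pi / T : ℝ) * (h p.2 : ℂ) := by
  rw [harmonicN, ← Matrix.diagonal_one, Matrix.diagonal_kronecker_diagonal]
  simp

/-- The eigenvalues of `Λ` belong to the spectrum of `Λ ⊗ ℐ - 𝒩`. -/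
theorem mem_matrixSpectrum_kronecker_sub_harmonicN {Λ : Matrix (Fin n) (Fin n) ℂ} {μ : ℂ}
    {v : Fin n → ℂ} (hv : v ≠ 0) (hμ : Λ.mulVec v = μ • v) :
    μ ∈ matrixSpectrum (Λ ⊗ₖ (1 : Matrix ℤ ℤ ℂ) - harmonicN n T (fun k : ℤ => k)) := by
  rintro ⟨R, -, hR⟩
  -- The eigenvector is placed at harmonic `0`, where `𝒩` vanishes; it is then a kernel vector,
  -- which excludes a left inverse.
  set e : Fin n → Fin n × ℤ := fun a => (a, 0) with he
  have hinj : e.Injective := Prod.mk_left_injective 0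
  have hsum : ∀ p, HasSum (fun q => (Λ ⊗ₖ (1 : Matrix ℤ ℤ ℂ) - harmonicN n T (fun k : ℤ => k) -
      μ • (1 : Matrix (Fin n × ℤ) (Fin n × ℤ) ℂ)) p q * finExtend e v q) 0 := by
    rintro ⟨a, k⟩
    convert hasSum_mul_finExtend hinj _ v using 1
    have h1 := congrFun hμ a
    simp only [Matrix.mulVec, dotProduct, Pi.smul_apply, smul_eq_mul] at h1
    rw [harmonicN_eq_diagonal]
    by_cases hk : k = 0
    · subst hk
      simp only [he, Matrix.sub_apply, Matrix.kroneckerMap_apply, Matrix.one_apply_eq, mul_one,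
        Matrix.smul_apply, smul_eq_mul, sub_mul, Finset.sum_sub_distrib, h1]
      simp [Matrix.diagonal_apply, Matrix.one_apply]
    · simp [he, hk]
  have htsum : (fun p => ∑' q, (Λ ⊗ₖ (1 : Matrix ℤ ℤ ℂ) - harmonicN n T (fun k : ℤ => k) -
      μ • (1 : Matrix (Fin n × ℤ) (Fin n × ℤ) ℂ)) p q * finExtend e v q) = 0 :=
    funext fun p => (hsum p).tsum_eq
  have hmem : finExtend e v ∈ (matrixOp (Λ ⊗ₖ (1 : Matrix ℤ ℤ ℂ) -
      harmonicN n T (fun k : ℤ => k) - μ • (1 : Matrix (Fin n × ℤ) (Fin n × ℤ) ℂ))).domain :=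
    ⟨fun p => (hsum p).summable, by rw [htsum]; exact zero_memℓp⟩
  have h0 := hR ⟨finExtend e v, hmem⟩
  have hzero : matrixOp (Λ ⊗ₖ (1 : Matrix ℤ ℤ ℂ) - harmonicN n T (fun k : ℤ => k) -
      μ • (1 : Matrix (Fin n × ℤ) (Fin n × ℤ) ℂ)) ⟨finExtend e v, hmem⟩ = 0 := by
    ext p
    exact congrFun htsum p
  rw [hzero, map_zero] at h0
  refine hv (funext fun a => ?_)
  rw [← finExtend_apply hinj v a]
  exact congrArg (fun y : Ell2 (Fin n × ℤ) => y (e a)) h0.symm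

/-- All rows of the shifted matrix applied to `y` sum to zero, so `y` belongs to the maximal domain
and the left inverse kills it. -/
theorem eq_zero_of_notMem_matrixSpectrum {A : ℝ → Matrix (Fin n) (Fin n) ℂ} {μ : ℂ}
    {E : Ell2 (Fin n × ℤ) →L[ℂ] Ell2 (Fin n × ℤ)} (hE : HasMatrix E (blockToeplitz T A))
    (hμ : μ ∉ matrixSpectrum (blockToeplitz T A - harmonicN n T (fun k : ℤ => k)))
    {y : Ell2 (Fin n × ℤ)}
    (hy : ∀ p, -(Complex.I * (2 * Real.pi / T : ℝ) * (p.2 : ℂ)) * y p + E y p = μ * y p) :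
    y = 0 := by
  obtain ⟨R, -, hR⟩ := not_not.1 hμ
  have hM : blockToeplitz T A - harmonicN n T (fun k : ℤ => k) -
      μ • (1 : Matrix (Fin n × ℤ) (Fin n × ℤ) ℂ) = Matrix.diagonal
        (fun p => -(Complex.I * (2 * Real.pi / T : ℝ) * (p.2 : ℂ)) - μ) + blockToeplitz T A := by
    rw [harmonicN_eq_diagonal]
    ext p q
    by_cases h : p = q
    · subst h
      simp only [Matrix.sub_apply, Matrix.diagonal_apply_eq, Matrix.smul_apply,
        Matrix.one_apply_eq, smul_eq_mul, Matrix.add_apply]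
      ring
    · simp [Matrix.diagonal_apply_ne _ h, Matrix.one_apply_ne h]
  have hsum : ∀ p, HasSum (fun q => (blockToeplitz T A - harmonicN n T (fun k : ℤ => k) -
      μ • (1 : Matrix (Fin n × ℤ) (Fin n × ℤ) ℂ)) p q * y q) 0 := by
    intro p
    convert hasSum_diagonal_add hE hM y p using 1
    linear_combination -(hy p)
  have htsum : (fun p => ∑' q, (blockToeplitz T A - harmonicN n T (fun k : ℤ => k) -
      μ • (1 : Matrix (Fin n × ℤ) (Fin n × ℤ) ℂ)) p q * y q) = 0 :=
    funext fun p => (hsum p).tsum_eq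
  have hmem : y ∈ (matrixOp (blockToeplitz T A - harmonicN n T (fun k : ℤ => k) -
      μ • (1 : Matrix (Fin n × ℤ) (Fin n × ℤ) ℂ))).domain :=
    ⟨fun p => (hsum p).summable, by rw [htsum]; exact zero_memℓp⟩
  have h0 := hR ⟨y, hmem⟩
  have hzero : matrixOp (blockToeplitz T A - harmonicN n T (fun k : ℤ => k) -
      μ • (1 : Matrix (Fin n × ℤ) (Fin n × ℤ) ℂ)) ⟨y, hmem⟩ = 0 := by
    ext p
    exact congrFun htsum p
  rw [hzero, map_zero] at h0
  exact h0.symm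

/-- A linear map that intertwines `Λ` with a linear relation `r` vanishes as soon as `r` has no
eigenvalue in common with `Λ`. -/
theorem eq_zero_of_intertwining {X : Type*} [AddCommGroup X] [Module ℂ X]
    (Λ : Matrix (Fin n) (Fin n) ℂ) (Y : (Fin n → ℂ) →ₗ[ℂ] X) (r : X → X → Prop)
    (hr : ∀ c, r (Y c) (Y (Λ.mulVec c)))
    (hμ : ∀ (μ : ℂ) (v : Fin n → ℂ), v ≠ 0 → Λ.mulVec v = μ • v → ∀ y, r y (μ • y) → y = 0) :
    Y = 0 := by
  set f : Module.End ℂ (Fin n → ℂ) := Matrix.mulVecLin Λ with hf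
  -- Induction on the order of a generalized eigenvector: if `Y` kills `(Λ - μ) c`, then `Y (Λ c) =
  -- μ Y c`, so `Y c` is an eigenvector of `r` or zero. The generalized eigenspaces span `ℂⁿ`.
  have key : ∀ (μ : ℂ) (k : ℕ) (c : Fin n → ℂ), ((f - μ • 1) ^ k) c = 0 → Y c = 0 := by
    intro μ k
    induction k with
    | zero => intro c hc; simp_all
    | succ k ih =>
      intro c hc
      rw [pow_succ, Module.End.mul_apply] at hc
      have h1 := ih _ hc
      have h2 : (f - μ • 1) c = Λ.mulVec c - μ • c := by simp [hf]
      rw [h2, map_sub, map_smul, sub_eq_zero] at h1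
      -- If `μ` is not an eigenvalue of `Λ`, then `Λ - μ` is injective and `c` itself is zero.
      by_cases h : ∃ v : Fin n → ℂ, v ≠ 0 ∧ Λ.mulVec v = μ • v
      · obtain ⟨v, hv, hv'⟩ := h
        refine hμ μ v hv hv' _ ?_
        rw [← h1]
        exact hr c
      · push Not at h
        have hinj : ∀ v, (f - μ • 1) v = 0 → v = 0 := by
          intro v hv
          by_contra hv0
          refine h v hv0 ?_
          rw [← sub_eq_zero, ← hv]
          simp [hf]
        have hz : c = 0 := by
          refine hinj c ?_
          clear ih h1 h2
          have : Function.Injective ⇑((f - μ • 1) ^ k) := by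
            rw [Module.End.coe_pow]
            exact ((injective_iff_map_eq_zero (f - μ • 1)).2 hinj).iterate k
          exact (injective_iff_map_eq_zero _).1 this _ hc
        rw [hz, map_zero]
  have htop := Module.End.iSup_maxGenEigenspace_eq_top f
  rw [← LinearMap.ker_eq_top, eq_top_iff, ← htop, iSup_le_iff]
  intro μ c hc
  obtain ⟨k, hk⟩ := (Module.End.mem_maxGenEigenspace f μ c).1 hc
  exact key μ k c hk

/-- The diagonal part of the matrix of the Sylvester equation, shifted by `-1`. -/
noncomputable def sylvesterDiag (n : ℕ) (T : ℝ) (p : Fin n × (Fin n × ℤ)) : ℂ :=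
  -(Complex.I * (2 * Real.pi / T : ℝ) * (p.2.2 : ℂ)) - 1

theorem sylvesterDiag_re (p : Fin n × (Fin n × ℤ)) : (sylvesterDiag n T p).re = -1 := by
  simp [sylvesterDiag]

theorem sylvesterDiag_im (p : Fin n × (Fin n × ℤ)) :
    (sylvesterDiag n T p).im = -(2 * Real.pi / T * p.2.2) := by
  simp [sylvesterDiag]

/-- The shift by `-1` is what keeps the diagonal away from zero at `k = 0`; the bounded part
compensates with `E + 1`. -/
theorem sylvesterDiag_ne_zero (p : Fin n × (Fin n × ℤ)) : sylvesterDiag n T p ≠ 0 := by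
  intro h
  have h1 := sylvesterDiag_re (T := T) p
  rw [h] at h1
  norm_num at h1

theorem norm_inv_sylvesterDiag_le_one (p : Fin n × (Fin n × ℤ)) :
    ‖(sylvesterDiag n T p)⁻¹‖ ≤ 1 := by
  rw [norm_inv]
  refine inv_le_one_of_one_le₀ ?_
  have h := Complex.abs_re_le_norm (sylvesterDiag n T p)
  rwa [sylvesterDiag_re, abs_neg, abs_one] at h

theorem norm_inv_sylvesterDiag_le (hT : 0 < T) (p : Fin n × (Fin n × ℤ)) (hp : p.2.2 ≠ 0) :
    ‖(sylvesterDiag n T p)⁻¹‖ ≤ (2 * Real.pi / T * |(p.2.2 : ℝ)|)⁻¹ := by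
  have hω : 0 < 2 * Real.pi / T := by positivity
  have hp' : 0 < |(p.2.2 : ℝ)| := abs_pos.2 (by exact_mod_cast hp)
  rw [norm_inv]
  refine inv_anti₀ (by positivity) ?_
  have h := Complex.abs_im_le_norm (sylvesterDiag n T p)
  rwa [sylvesterDiag_im, abs_neg, abs_mul, abs_of_pos hω] at h

theorem memℓp_inv_sylvesterDiag (hT : 0 < T) :
    Memℓp (fun p => (sylvesterDiag n T p)⁻¹) 2 := by
  rw [memℓp_two_iff]
  refine summable_prod_of_finite (fun _ => by positivity) fun b =>
    summable_prod_of_finite (fun _ => by positivity) fun a => ?_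
  have hω : 0 < 2 * Real.pi / T := by positivity
  -- The extra term serves `k = 0`, where `1 / k ^ 2` is `0` by convention while the diagonal entry
  -- has modulus one.
  have h1 : Summable fun k : ℤ => ((2 * Real.pi / T) ^ 2)⁻¹ * (1 / (k : ℝ) ^ 2) +
      if k = 0 then 1 else 0 :=
    ((Real.summable_one_div_int_pow.2 one_lt_two).mul_left _).add (hasSum_ite_eq 0 1).summable
  refine h1.of_nonneg_of_le (fun _ => by positivity) fun k => ?_
  by_cases hk : k = 0
  · subst hk
    have := norm_inv_sylvesterDiag_le_one (T := T) (b, (a, (0 : ℤ)))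
    simpa using pow_le_one₀ (norm_nonneg _) this
  · have := norm_inv_sylvesterDiag_le hT (b, (a, k)) hk
    rw [if_neg hk, add_zero]
    calc _ ≤ ((2 * Real.pi / T * |(k : ℝ)|)⁻¹) ^ 2 := by gcongr
      _ = _ := by rw [inv_pow, mul_pow, sq_abs, mul_inv, one_div]

/-- The embedding of the harmonics of order at most `m`. -/
def harmEmb (n m : ℕ) (p : Fin n × (Fin n × Harm m)) : Fin n × (Fin n × ℤ) :=
  (p.1, (p.2.1, (p.2.2 : ℤ)))

theorem harmEmb_injective (n m : ℕ) : (harmEmb n m).Injective := by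
  rintro ⟨b, a, k⟩ ⟨b', a', k'⟩ h
  simp only [harmEmb, Prod.mk.injEq, Subtype.val_inj] at h
  obtain ⟨rfl, rfl, rfl⟩ := h
  rfl

theorem mem_range_harmEmb {m : ℕ} {p : Fin n × (Fin n × ℤ)} :
    p ∈ Set.range (harmEmb n m) ↔ p.2.2 ∈ Finset.Icc (-(m : ℤ)) m :=
  ⟨by rintro ⟨q, rfl⟩; exact q.2.2.2, fun h => ⟨(p.1, (p.2.1, ⟨p.2.2, h⟩)), rfl⟩⟩

theorem norm_inv_sylvesterDiag_le_of_notMem (hT : 0 < T) {m : ℕ} {p : Fin n × (Fin n × ℤ)}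
    (hp : p ∉ Set.range (harmEmb n m)) :
    ‖(sylvesterDiag n T p)⁻¹‖ ≤ (2 * Real.pi / T)⁻¹ * (1 / ((m : ℝ) + 1)) := by
  rw [mem_range_harmEmb, Finset.mem_Icc, ← abs_le, not_le] at hp
  have hp0 : p.2.2 ≠ 0 := by
    intro h
    rw [h, abs_zero] at hp
    omega
  refine (norm_inv_sylvesterDiag_le hT p hp0).trans ?_
  have hω : 0 < 2 * Real.pi / T := by positivity
  rw [mul_inv, one_div]
  gcongr
  exact_mod_cast hp

theorem coe_finExtend_harmEmb {m : ℕ} (x : Fin n × (Fin n × Harm m) → ℂ) :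
    (finExtend (harmEmb n m) x : Fin n × (Fin n × ℤ) → ℂ) = extendByZero x := by
  funext p
  by_cases h : p.2.2 ∈ Finset.Icc (-(m : ℤ)) m
  · rw [extendByZero, dif_pos h]
    exact finExtend_apply (harmEmb_injective n m) x (p.1, (p.2.1, ⟨p.2.2, h⟩))
  · rw [extendByZero, dif_neg h]
    exact finExtend_apply_of_notMem _ _ (mt mem_range_harmEmb.1 h)

/-- Truncation acts on harmonics only, so it commutes with both products; the truncated problem is
thus a finite section of the infinite one. -/
theorem truncSylvesterMatrix_eq (A : ℝ → Matrix (Fin n) (Fin n) ℂ) (Λ : Matrix (Fin n) (Fin n) ℂ)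
    (m : ℕ) : truncSylvesterMatrix T A Λ m =
      (sylvesterMatrix T A Λ).submatrix (harmEmb n m) (harmEmb n m) := by
  ext p q
  obtain ⟨b, a, k⟩ := p
  obtain ⟨b', a', l⟩ := q
  simp only [truncSylvesterMatrix, sylvesterMatrix, harmEmb, truncMatrix, circProd,
    harmonicN_eq_diagonal, Matrix.diagonal_apply, Matrix.one_apply, Matrix.kroneckerMap_apply,
    Matrix.sub_apply, Matrix.submatrix_apply, Matrix.transpose_apply, Matrix.of_apply,
    Prod.mk.injEq, Subtype.val_inj]

/-- The bounded part of the matrix of the Sylvester equation. -/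
noncomputable def sylvesterBounded (E : Ell2 (Fin n × ℤ) →L[ℂ] Ell2 (Fin n × ℤ))
    (Λ : Matrix (Fin n) (Fin n) ℂ) :
    Ell2 (Fin n × (Fin n × ℤ)) →L[ℂ] Ell2 (Fin n × (Fin n × ℤ)) :=
  blockOp fun b b' => (if b = b' then E + 1 else 0) - Λ b' b • 1

theorem hasMatrix_sylvesterBounded {A : ℝ → Matrix (Fin n) (Fin n) ℂ}
    {E : Ell2 (Fin n × ℤ) →L[ℂ] Ell2 (Fin n × ℤ)} (hE : HasMatrix E (blockToeplitz T A))
    (Λ : Matrix (Fin n) (Fin n) ℂ) :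
    HasMatrix (sylvesterBounded E Λ)
      (sylvesterMatrix T A Λ - Matrix.diagonal (sylvesterDiag n T)) := by
  rw [hasMatrix_iff] at hE ⊢
  rintro ⟨b, a, k⟩ ⟨b', a', l⟩
  rw [sylvesterBounded, blockOp_single]
  have h1 := hE (a, k) (a', l)
  have h2 : ((if b = b' then E + 1 else 0) - Λ b' b • 1 :
      Ell2 (Fin n × ℤ) →L[ℂ] Ell2 (Fin n × ℤ)) (lp.single 2 (a', l) 1) (a, k) =
      (if b = b' then blockToeplitz T A (a, k) (a', l) + (if (a, k) = (a', l) then 1 else 0)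
        else 0) - Λ b' b * (if (a, k) = (a', l) then 1 else 0) := by
    have h3 : ∀ x : Ell2 (Fin n × ℤ), ((if b = b' then E + 1 else 0) - Λ b' b • 1 :
        Ell2 (Fin n × ℤ) →L[ℂ] Ell2 (Fin n × ℤ)) x (a, k) =
        (if b = b' then E x (a, k) + x (a, k) else 0) - Λ b' b * x (a, k) := by
      intro x
      split_ifs <;> rfl
    rw [h3, h1, lp.coeFn_single, Pi.single_apply]
  rw [h2]
  simp only [sylvesterMatrix, harmonicN_eq_diagonal, circProd, Matrix.sub_apply,
    Matrix.kroneckerMap_apply, Matrix.diagonal_apply, Matrix.one_apply, Matrix.of_apply,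
    Matrix.transpose_apply, sylvesterDiag, Prod.mk.injEq]
  by_cases hb : b = b' <;> by_cases ha : a = a' <;> by_cases hk : k = l <;>
    (simp [hb, ha, hk, eq_comm (a := l)]; try ring)

end HarmonicSylvester

/-! ### Uniqueness, transfer to periodic functions, and the theorem -/

section TruncationTheorem

open Filter Topology

variable {n : ℕ} {T : ℝ}

/-- Uniqueness for the homogeneous Sylvester equation when the spectra are disjoint. -/
theorem eq_zero_of_sylvester_eq_zero {A : ℝ → Matrix (Fin n) (Fin n) ℂ}
    {Λ : Matrix (Fin n) (Fin n) ℂ} {E : Ell2 (Fin n × ℤ) →L[ℂ] Ell2 (Fin n × ℤ)}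
    (hE : HasMatrix E (blockToeplitz T A))
    (hσ : matrixSpectrum (blockToeplitz T A - harmonicN n T (fun k : ℤ => k)) ∩
      matrixSpectrum (Λ ⊗ₖ (1 : Matrix ℤ ℤ ℂ) - harmonicN n T (fun k : ℤ => k)) = ∅)
    {x : Ell2 (Fin n × (Fin n × ℤ))}
    (hx : ∀ p, sylvesterDiag n T p * x p + sylvesterBounded E Λ x p = 0) : x = 0 := by
  set X : Fin n → Ell2 (Fin n × ℤ) :=
    fun b => pullOp (Prod.mk b) (Prod.mk_right_injective b) x with hX
  -- The equation column by column, with the shift cancelled: `(𝒜 - 𝒩) X_b = ∑ Λ_{b'b} X_{b'}`.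
  have hXeq : ∀ b (p : Fin n × ℤ), -(Complex.I * (2 * Real.pi / T : ℝ) * (p.2 : ℂ)) * X b p +
      E (X b) p = ∑ b', Λ b' b * X b' p := by
    intro b p
    have h2 : ∀ b', ((if b = b' then E + 1 else 0) - Λ b' b • 1 :
        Ell2 (Fin n × ℤ) →L[ℂ] Ell2 (Fin n × ℤ)) (X b') p =
        (if b = b' then E (X b') p + X b' p else 0) - Λ b' b * X b' p := by
      intro b'
      split_ifs <;> rfl
    have h1 : sylvesterDiag n T (b, p) * X b p + ∑ b', ((if b = b' then E + 1 else 0) -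
        Λ b' b • 1 : Ell2 (Fin n × ℤ) →L[ℂ] Ell2 (Fin n × ℤ)) (X b') p = 0 := by
      have h := hx (b, p)
      rw [sylvesterBounded, blockOp_apply] at h
      exact h
    rw [Finset.sum_congr rfl fun b' _ => h2 b', sylvesterDiag] at h1
    simp only [Finset.sum_sub_distrib, Finset.sum_ite_eq, Finset.mem_univ, if_true] at h1
    linear_combination h1
  -- `c ↦ ∑ c_b X_b` is the intertwiner. The unbounded `𝒜 - 𝒩` enters as a coordinatewise relation,
  -- which avoids its domain.
  have hY := eq_zero_of_intertwining Λ (Fintype.linearCombination ℂ X)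
    (fun y z => ∀ p : Fin n × ℤ, -(Complex.I * (2 * Real.pi / T : ℝ) * (p.2 : ℂ)) * y p +
      E y p = z p) ?_ ?_
  · ext ⟨b, p⟩
    have h1 := DFunLike.congr_fun hY (Pi.single b 1)
    rw [Fintype.linearCombination_apply_single, one_smul] at h1
    exact congrArg (fun y : Ell2 (Fin n × ℤ) => y p) h1
  · intro c p
    simp only [Fintype.linearCombination_apply, map_sum, map_smul, lp.coeFn_sum, lp.coeFn_smul,
      Finset.sum_apply, Pi.smul_apply, smul_eq_mul, Matrix.mulVec, dotProduct]
    rw [Finset.mul_sum, ← Finset.sum_add_distrib]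
    simp only [Finset.sum_mul]
    rw [Finset.sum_comm]
    refine Finset.sum_congr rfl fun b _ => ?_
    have h1 := hXeq b p
    calc _ = c b * (-(Complex.I * (2 * Real.pi / T : ℝ) * (p.2 : ℂ)) * X b p + E (X b) p) := by
          ring
      _ = _ := by
          rw [h1, Finset.mul_sum]
          exact Finset.sum_congr rfl fun _ _ => by ring
  · intro μ v hv hΛv y hy
    have h2 := mem_matrixSpectrum_kronecker_sub_harmonicN (T := T) hv hΛv
    have h1 : μ ∉ matrixSpectrum (blockToeplitz T A - harmonicN n T (fun k : ℤ => k)) := by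
      intro h
      have : μ ∈ (∅ : Set ℂ) := hσ ▸ ⟨h, h2⟩
      exact this
    exact eq_zero_of_notMem_matrixSpectrum hE h1 hy

/-- Products of `L^∞` functions are in `L^∞`, hence in `L²` on an interval of finite measure. -/
theorem memLp_two_mul_entry {r : ℕ} {B : ℝ → Matrix (Fin n) (Fin r) ℂ}
    {G : ℝ → Matrix (Fin r) (Fin n) ℂ} (hB : PeriodicLp ∞ T B) (hG : PeriodicLp ∞ T G)
    (a b : Fin n) :
    MemLp (fun t => (B t * G t) a b) 2 (volume.restrict (Set.Icc 0 T)) := by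
  have h : MemLp (fun t => ∑ l, B t a l * G t l b) ∞ (volume.restrict (Set.Icc 0 T)) :=
    memLp_finsetSum _ fun l _ => (hG.2 l b).mul (hB.2 a l)
  exact h.mono_exponent le_top

theorem memℓp_colPhasor (hT : 0 < T) {F : ℝ → Matrix (Fin n) (Fin n) ℂ}
    (hF : ∀ a b, MemLp (fun t => F t a b) 2 (volume.restrict (Set.Icc 0 T))) :
    Memℓp (colPhasor T F) 2 := by
  rw [memℓp_two_iff]
  refine summable_prod_of_finite (fun _ => by positivity) fun b =>
    summable_prod_of_finite (fun _ => by positivity) fun a => ?_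
  obtain ⟨x, hx⟩ := exists_phasor_eq_of_memLp hT (hF a b)
  have h := Ell2.summable_norm_sq x
  simp only [hx] at h
  exact h

theorem exists_periodicLp_colPhasor_eq (hT : 0 < T) (x : Ell2 (Fin n × (Fin n × ℤ))) :
    ∃ P : ℝ → Matrix (Fin n) (Fin n) ℂ, PeriodicLp 2 T P ∧
      colPhasor T P = (x : Fin n × (Fin n × ℤ) → ℂ) := by
  choose f hper hmem hf using fun b a => exists_periodic_memLp_phasor_eq hT
    (pullOp (Prod.mk a) (Prod.mk_right_injective a)
      (pullOp (Prod.mk b) (Prod.mk_right_injective b) x))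
  refine ⟨fun t => Matrix.of fun a b => f b a t, ⟨fun t => ?_, fun a b => hmem b a⟩, ?_⟩
  · ext a b
    exact hper b a t
  · funext ⟨b, a, k⟩
    exact hf b a k

theorem blockToeplitz_eq_of_colPhasor {F : ℝ → Matrix (Fin n) (Fin n) ℂ} :
    blockToeplitz T F = Matrix.of fun p q => colPhasor T F (q.1, (p.1, p.2 - q.2)) := rfl

theorem colPhasor_ofTruncPhasors (hT : 0 < T) {m : ℕ} (x : Fin n × (Fin n × Harm m) → ℂ) :
    colPhasor T (ofTruncPhasors T x) = extendByZero x := by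
  funext ⟨b, a, k⟩
  change phasor T (fun t : ℝ => ∑ l : Harm m, x (b, (a, l)) *
    Complex.exp (Complex.I * (2 * Real.pi / T : ℝ) * ((l : ℤ) : ℂ) * t)) k = _
  rw [phasor_trigPolynomial hT (fun l : Harm m => (l : ℤ)) (fun l => x (b, (a, l)))]
  by_cases h : k ∈ Finset.Icc (-(m : ℤ)) m
  · rw [Finset.sum_eq_single ⟨k, h⟩, if_pos rfl]
    · rw [extendByZero, dif_pos h]
    · intro l _ hl
      rw [if_neg fun h' => hl (Subtype.ext h')]
    · simp
  · rw [Finset.sum_eq_zero]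
    · rw [extendByZero, dif_neg h]
    · intro l _
      rw [if_neg]
      rintro rfl
      exact h l.2

theorem HasMatrix.sub {ι : Type*} {D D' : Ell2 ι →L[ℂ] Ell2 ι} {M M' : Matrix ι ι ℂ}
    (h : HasMatrix D M) (h' : HasMatrix D' M') : HasMatrix (D - D') (M - M') := by
  intro x i
  simp only [Matrix.sub_apply, sub_mul]
  exact (h x i).sub (h' x i)

theorem ell2NormLT_coe {ι : Type*} {x : Ell2 ι} {ε : ℝ} (h : ‖x‖ < ε) : Ell2NormLT x ε :=
  ⟨x.2, h⟩

end TruncationTheorem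

theorem theorem6 {n r : ℕ} {T : ℝ} (hT : 0 < T)
    (A : ℝ → Matrix (Fin n) (Fin n) ℂ) (B : ℝ → Matrix (Fin n) (Fin r) ℂ)
    (G : ℝ → Matrix (Fin r) (Fin n) ℂ) (Λ : Matrix (Fin n) (Fin n) ℂ)
    (hA : PeriodicLp ∞ T A) (hB : PeriodicLp ∞ T B) (hG : PeriodicLp ∞ T G)
    (hσ : matrixSpectrum (blockToeplitz T A - harmonicN n T (fun k : ℤ => k)) ∩
      matrixSpectrum (Λ ⊗ₖ (1 : Matrix ℤ ℤ ℂ) - harmonicN n T (fun k : ℤ => k)) = ∅) :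
    ∃ (R : Ell2 (Fin n × (Fin n × ℤ)) →L[ℂ] Ell2 (Fin n × (Fin n × ℤ)))
      (q : Ell2 (Fin n × (Fin n × ℤ))),
      IsBoundedInverse (matrixOp (sylvesterMatrix T A Λ)) R ∧
      (q : Fin n × (Fin n × ℤ) → ℂ) = colPhasor T (fun t => B t * G t) ∧
      (∃ P : ℝ → Matrix (Fin n) (Fin n) ℂ, PeriodicLp 2 T P ∧
        colPhasor T P = (R q : Fin n × (Fin n × ℤ) → ℂ)) ∧
      ∀ P : ℝ → Matrix (Fin n) (Fin n) ℂ, PeriodicLp 2 T P →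
        colPhasor T P = (R q : Fin n × (Fin n × ℤ) → ℂ) →
        ∃ D : Ell2 (Fin n × ℤ) →L[ℂ] Ell2 (Fin n × ℤ),
          HasMatrix D (blockToeplitz T P) ∧
          ∀ ε : ℝ, 0 < ε → ∃ m₀ : ℕ, ∀ m : ℕ, m₀ ≤ m →
            IsUnit (truncSylvesterMatrix T A Λ m).det ∧
            Ell2NormLT (colPhasor T P -
              extendByZero (truncSolution T A Λ (fun t => B t * G t) m)) ε ∧
            ∃ Dm : Ell2 (Fin n × ℤ) →L[ℂ] Ell2 (Fin n × ℤ),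
              HasMatrix Dm (blockToeplitz T
                (ofTruncPhasors T (truncSolution T A Λ (fun t => B t * G t) m))) ∧
              ‖D - Dm‖ < ε := by
  obtain ⟨E, hE⟩ := exists_hasMatrix_blockToeplitz hT hA
  have hδ : Filter.Tendsto (fun m : ℕ => (2 * Real.pi / T)⁻¹ * (1 / ((m : ℝ) + 1))) Filter.atTop
      (nhds 0) := by
    simpa using tendsto_one_div_add_atTop_nhds_zero_nat.const_mul (2 * Real.pi / T)⁻¹
  obtain ⟨R, hR, hdet, hconv⟩ := finite_section_method (M := sylvesterMatrix T A Λ)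
    (E := sylvesterBounded E Λ) (harmEmb_injective n) sylvesterDiag_ne_zero
    norm_inv_sylvesterDiag_le_one
    (hasSum_diagonal_add (hasMatrix_sylvesterBounded hE Λ) (add_sub_cancel _ _).symm)
    hδ (fun m => by positivity) (fun m p hp => norm_inv_sylvesterDiag_le_of_notMem hT hp)
    (memℓp_inv_sylvesterDiag hT) (fun x hx => eq_zero_of_sylvester_eq_zero hE hσ hx)
  set q : Ell2 (Fin n × (Fin n × ℤ)) :=
    ⟨colPhasor T (fun t => B t * G t), memℓp_colPhasor hT (memLp_two_mul_entry hB hG)⟩ with hq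
  obtain ⟨hsum, hlim⟩ := hconv q
  set u : ℕ → Ell2 (Fin n × (Fin n × ℤ)) := fun m =>
    finExtend (harmEmb n m) (truncSolution T A Λ (fun t => B t * G t) m) with hu
  obtain ⟨hlim2, hsub, hlim1⟩ := hlim u fun m => by
    rw [← truncSylvesterMatrix_eq]
    rfl
  refine ⟨R, q, hR, rfl, exists_periodicLp_colPhasor_eq hT _, fun P _ hP => ?_⟩
  -- The limit `P` is only known to be in `L²`; its Toeplitz operator is bounded because its phasors
  -- are absolutely summable.
  obtain ⟨D, hD, -⟩ := exists_hasMatrix_of_summable hsum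
  rw [← hP, ← blockToeplitz_eq_of_colPhasor] at hD
  refine ⟨D, hD, fun ε hε => ?_⟩
  have hev := (hdet.and ((tendsto_iff_norm_sub_tendsto_zero.1 hlim2).eventually
    (gt_mem_nhds hε))).and (hlim1.eventually (gt_mem_nhds hε))
  obtain ⟨m₀, hm₀⟩ := Filter.eventually_atTop.1 hev
  refine ⟨m₀, fun m hm => ?_⟩
  obtain ⟨⟨h1, h2⟩, h3⟩ := hm₀ m hm
  refine ⟨by rwa [truncSylvesterMatrix_eq], ?_, ?_⟩
  · have heq : colPhasor T P - extendByZero (truncSolution T A Λ (fun t => B t * G t) m) =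
        ((R q - u m : Ell2 _) : Fin n × (Fin n × ℤ) → ℂ) := by
      rw [hP, ← coe_finExtend_harmEmb, lp.coeFn_sub]
    rw [heq]
    exact ell2NormLT_coe (by rwa [norm_sub_rev])
  · obtain ⟨D', hD', hnorm⟩ := exists_hasMatrix_of_summable (hsub m)
    refine ⟨D - D', ?_, ?_⟩
    · convert hD.sub hD' using 1
      rw [blockToeplitz_eq_of_colPhasor, blockToeplitz_eq_of_colPhasor,
        colPhasor_ofTruncPhasors hT, hP, ← coe_finExtend_harmEmb]
      ext i j
      simp [hu]
    · rw [sub_sub_cancel]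
      exact hnorm.trans_lt h3
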